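/- Let $d\ge 1$. For $\gamma\in(0,1]$ and $a>0$, a (Lebesgue) measurable set $\omega\subset\mathbb{R}^d$ is called $(\gamma,a)$-thick if $|\omega\cap(x+[0,a]^d)|\ge \gamma a^d$ for every $x\in\mathbb{R}^d$. The Fourier transform on $L^2(\mathbb{R}^d;\mathbb{C})$ is normalised by $\widehat f(\xi)=\int_{\mathbb{R}^d} f(x)e^{-ix\cdot\xi}\,\mathrm{d}x$ (for $f \in L^1\cap L^2$, extended by continuity), and $B(0,N)=\{\xi\in\mathbb{R}^d : |\xi|\le N\}$. There exists a constant $C>0$, depending only on the dimension $d$, such that for all $\gamma\in(0,1]$ and $a>0$, every $(\gamma,a)$-thick measurable set $\omega\subset\mathbb{R}^d$, every $N\ge 0$, and every $f\in L^2(\mathbb{R}^d;\mathbb{C})$ with $\operatorname{supp}\widehat f\subset B(0,N)$, one has $$\|f\|_{L^2(\mathbb{R}^d)}\le\left(\frac{C}{\gamma}\right)^{C(Na+1)}\|f\|_{L^2(\omega)}.$$ -/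

import Mathlib

open MeasureTheory FourierTransform Topology

namespace LogvinenkoSereda

/-- The closed axis-parallel cube `x + [0,a]^d`. -/
def cube {d : ℕ} (x : EuclideanSpace ℝ (Fin d)) (a : ℝ) : Set (EuclideanSpace ℝ (Fin d)) :=
  {y | ∀ i, y i ∈ Set.Icc (x i) (x i + a)}

/-- `ω` is `(γ,a)`-thick: `|ω ∩ (x + [0,a]^d)| ≥ γ a^d` for every `x`. Measurability of `ω` and
the ranges of `γ` and `a` are kept as separate hypotheses. -/
def IsThick {d : ℕ} (γ a : ℝ) (ω : Set (EuclideanSpace ℝ (Fin d))) : Prop :=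
  ∀ x : EuclideanSpace ℝ (Fin d), ENNReal.ofReal (γ * a ^ d) ≤ volume (ω ∩ cube x a)

/-- The Fourier transform on `L²(ℝ^d; ℂ)` in the normalisation `∫ f(x) e^{-i x·ξ} dx`
(for `f ∈ L¹ ∩ L²`). Mathlib's `𝓕` has the kernel `e^{-2π i x·ξ}`, so it is evaluated
at `ξ / (2π)`. -/
noncomputable def fourierHat {d : ℕ}
    (f : Lp ℂ 2 (volume : Measure (EuclideanSpace ℝ (Fin d)))) :
    EuclideanSpace ℝ (Fin d) → ℂ :=
  fun ξ => (𝓕 f : Lp ℂ 2 (volume : Measure (EuclideanSpace ℝ (Fin d)))) ((2 * Real.pi)⁻¹ • ξ)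

/-- The support of (the a.e. class of) `g`: the points no neighbourhood of which `g` vanishes
almost everywhere on. -/
def essSupport {d : ℕ} (g : EuclideanSpace ℝ (Fin d) → ℂ) : Set (EuclideanSpace ℝ (Fin d)) :=
  {ξ | ∀ U ∈ 𝓝 ξ, volume {η ∈ U | g η ≠ 0} ≠ 0}

end LogvinenkoSereda

/-! An affine change of variables turns a cube of side `a` into the unit cube, in which the rescaled
set has measure at least γ, and multiplies the spectral radius by `a`. Along a line, a band-limited
function superposes exponentials e^{ist} with bounded s. Lagrange interpolation at n+1 nodes in
(0,1] recovers the value at t = 0 of each such exponential up to 2|s|^(n+1)/(n+1)!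
(`norm_one_sub_sum_exp_le`). Inside any set of length τ the nodes can be spread out so that the
weights total O(1/τ)^n (`exists_nodes_weights`). By Tonelli, from every point of the cube there is a
segment meeting a given subset of measure m in length at least a constant times m
(`exists_direction`). Applied to a sublevel set inside ω, this bounds the function on the cube by
its L² norm over ω, with a factor (C/γ)^n, plus an error that is factorially small in n
(`sq_norm_fourierInv_le`).

That error carries the L¹ norm of the whole spectrum, which does not decay from cube to cube. Hence
f is first multiplied by a band-limited window ψ: Cauchy-Schwarz and Plancherel then bound the error
by a multiple of ‖fψ‖₂² (`lintegral_cube_le`). Integrating over all positions of the cube turns this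
into a multiple of ‖f‖₂². Taking n proportional to ar+1, where r is the spectral radius, makes the
multiple at most 1/2, so it is absorbed (`exists_const_lintegral_le`), and the same n produces the
exponent in the final bound. -/

namespace LogvinenkoSereda

/-! ### Lagrange extrapolation to the origin -/

/-- Iterated Rolle theorem for a sequence `D` of successive derivatives. -/
theorem exists_derivative_sequence_eq_zero (k : ℕ) : ∀ (D : ℕ → ℝ → ℝ) (z : ℕ → ℝ),
    (∀ j x, HasDerivAt (D j) (D (j + 1) x) x) →
    (∀ i < k, z i < z (i + 1)) → (∀ i ≤ k, D 0 (z i) = 0) → ∃ x, D k x = 0 := by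
  induction k with
  | zero =>
    intro D z _ _ h
    exact ⟨z 0, h 0 le_rfl⟩
  | succ k ih =>
    intro D z hD hz h
    have hR : ∀ i, ∃ c, i ≤ k → c ∈ Set.Ioo (z i) (z (i + 1)) ∧ D 1 c = 0 := by
      intro i
      by_cases hi : i ≤ k
      · obtain ⟨c, hc, hc'⟩ := exists_hasDerivAt_eq_zero (f := D 0) (f' := D 1)
          (hz i (by omega)) (fun x _ => (hD 0 x).continuousAt.continuousWithinAt)
          (by rw [h i (by omega), h (i + 1) (by omega)]) (fun x _ => hD 0 x)
        exact ⟨c, fun _ => ⟨hc, hc'⟩⟩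
      · exact ⟨0, fun h => absurd h hi⟩
    choose c hc using hR
    exact ih (fun j => D (j + 1)) c (fun j x => hD (j + 1) x)
      (fun i hi => ((hc i (by omega)).1.2).trans (hc (i + 1) (by omega)).1.1)
      (fun i hi => (hc i hi).2)

/-- Lagrange weight at the origin. -/
noncomputable def weight (n : ℕ) (v : ℕ → ℝ) (j : ℕ) : ℝ :=
  (Lagrange.basis (Finset.range (n + 1)) v j).eval 0

/-- The classical remainder argument: the error at 0 is a derivative of order n+1 over (n+1)!, times
the nodal polynomial at 0, whose absolute value is at most 1 because the nodes lie in (0,1]. -/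
theorem interpolation_error (n : ℕ) (v : ℕ → ℝ) (hv0 : 0 < v 0) (hv : ∀ i < n, v i < v (i + 1))
    (hv1 : ∀ i ≤ n, v i ≤ 1) (D : ℕ → ℝ → ℝ) (hD : ∀ j x, HasDerivAt (D j) (D (j + 1) x) x)
    (K : ℝ) (hK : ∀ x, |D (n + 1) x| ≤ K) :
    |D 0 0 - ∑ j ∈ Finset.range (n + 1), D 0 (v j) * weight n v j| ≤ K / (n + 1).factorial := by
  classical
  have hmono : ∀ i j, i < j → j ≤ n → v i < v j := by
    intro i j hij
    induction j, hij using Nat.le_induction with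
    | base => intro h; exact hv i (by omega)
    | succ j hj ih => intro h; exact (ih (by omega)).trans (hv j (by omega))
  have hpos : ∀ i ≤ n, 0 < v i := by
    intro i hi
    rcases Nat.eq_zero_or_pos i with rfl | h
    · exact hv0
    · exact hv0.trans (hmono 0 i h hi)
  have hinj : Set.InjOn v (Finset.range (n + 1) : Set ℕ) := by
    intro i hi j hj hij
    simp only [Finset.coe_range, Set.mem_Iio] at hi hj
    rcases lt_trichotomy i j with h | h | h
    · exact absurd hij (hmono i j h (by omega)).ne
    · exact h
    · exact absurd hij (hmono j i h (by omega)).ne'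
  set s := Finset.range (n + 1) with hs
  set P := Lagrange.interpolate s v (fun j => D 0 (v j)) with hP
  have hP0 : P.eval 0 = ∑ j ∈ s, D 0 (v j) * weight n v j := by
    simp [hP, Lagrange.interpolate_apply, Polynomial.eval_finsetSum, weight, hs]
  set Z := Lagrange.nodal s v with hZ
  have hZ0 : Z.eval 0 ≠ 0 := by
    rw [hZ, Lagrange.eval_nodal]
    refine Finset.prod_ne_zero_iff.2 fun i hi => ?_
    have := hpos i (by rw [hs, Finset.mem_range] at hi; omega)
    linarith
  have hZ1 : |Z.eval 0| ≤ 1 := by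
    rw [hZ, Lagrange.eval_nodal, Finset.abs_prod]
    refine Finset.prod_le_one (fun _ _ => abs_nonneg _) fun i hi => ?_
    have hi : i ≤ n := by rw [hs, Finset.mem_range] at hi; omega
    rw [zero_sub, abs_neg, abs_of_pos (hpos i hi)]
    exact hv1 i hi
  -- This κ makes P + κZ agree with the function at 0 as well as at the nodes. The difference then
  -- has n+2 zeros, and iterated Rolle identifies κ(n+1)! with a value of `D (n + 1)`.
  set κ := (D 0 0 - P.eval 0) / Z.eval 0 with hκ
  set R := P + Polynomial.C κ * Z with hR
  have hdeg : (Polynomial.derivative^[n + 1] R) = Polynomial.C (κ * (n + 1).factorial) := by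
    have hPd : P.natDegree < n + 1 := by
      by_cases hP00 : P = 0
      · simp [hP00]
      · have := Lagrange.degree_interpolate_lt (r := fun j => D 0 (v j)) hinj
        rw [← hP, hs, Finset.card_range] at this
        exact (Polynomial.natDegree_lt_iff_degree_lt hP00).2 this
    rw [hR, iterate_map_add, Polynomial.iterate_derivative_eq_zero hPd, zero_add,
      Polynomial.iterate_derivative_C_mul]
    have hm : Z.Monic := Lagrange.nodal_monic
    have hZd : Z.natDegree = n + 1 := by rw [hZ, Lagrange.natDegree_nodal, hs, Finset.card_range]
    have : Polynomial.derivative^[n + 1] Z = Polynomial.C ((n + 1).factorial : ℝ) := by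
      ext m
      rw [Polynomial.coeff_iterate_derivative, Polynomial.coeff_C]
      rcases Nat.eq_zero_or_pos m with rfl | hmp
      · have : Z.coeff (n + 1) = 1 := by rw [← hZd]; exact hm
        rw [zero_add, this, Nat.descFactorial_self, if_pos rfl, nsmul_eq_mul, mul_one]
      · rw [Polynomial.coeff_eq_zero_of_natDegree_lt (by omega), if_neg (by omega), smul_zero]
    rw [this, ← Polynomial.C_mul]
  obtain ⟨x, hx⟩ := exists_derivative_sequence_eq_zero (n + 1)
    (fun k x => D k x - (Polynomial.derivative^[k] R).eval x)
    (fun i => if i = 0 then 0 else v (i - 1))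
    (fun j x => by
      have h2 := (Polynomial.derivative^[j] R).hasDerivAt x
      rw [← Function.iterate_succ_apply' (⇑Polynomial.derivative)] at h2
      exact (hD j x).sub h2)
    (fun i hi => by
      rcases Nat.eq_zero_or_pos i with rfl | h
      · simpa using hv0
      · have := hv (i - 1) (by omega)
        rw [show i - 1 + 1 = i by omega] at this
        simpa [h.ne'] using this)
    (fun i hi => by
      rcases Nat.eq_zero_or_pos i with rfl | h
      · simp only [if_true, Function.iterate_zero, id, hR, Polynomial.eval_add,
          Polynomial.eval_mul, Polynomial.eval_C, hκ]
        field_simp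
        ring
      · have him : i - 1 ∈ s := by rw [hs, Finset.mem_range]; omega
        simp only [h.ne', if_false, Function.iterate_zero, id, hR, Polynomial.eval_add,
          Polynomial.eval_mul, hZ, Lagrange.eval_nodal_at_node him, mul_zero, add_zero, hP,
          Lagrange.eval_interpolate_at_node _ hinj him, sub_self])
  rw [hdeg, Polynomial.eval_C, sub_eq_zero] at hx
  have hfac : (0 : ℝ) < (n + 1).factorial := by exact_mod_cast Nat.factorial_pos _
  have hκK : |κ| ≤ K / (n + 1).factorial := by
    rw [le_div_iff₀ hfac]
    have := hK x
    rwa [hx, abs_mul, abs_of_pos hfac] at this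
  rw [← hP0]
  calc |D 0 0 - P.eval 0| = |κ| * |Z.eval 0| := by rw [← abs_mul, hκ, div_mul_cancel₀ _ hZ0]
    _ ≤ |κ| * 1 := by gcongr
    _ ≤ _ := by rwa [mul_one]

/-- Rolle is a real-variable tool, so the real and imaginary parts are treated separately, as cos(st
+ φ) with φ = 0 and φ = -π/2; this costs the factor 2. Successive derivatives are phase shifts by
π/2. -/
theorem norm_one_sub_sum_exp_le (n : ℕ) (v : ℕ → ℝ) (hv0 : 0 < v 0)
    (hv : ∀ i < n, v i < v (i + 1)) (hv1 : ∀ i ≤ n, v i ≤ 1) (s : ℝ) :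
    ‖1 - ∑ j ∈ Finset.range (n + 1), (weight n v j : ℂ) * Complex.exp ((s * v j : ℝ) * Complex.I)‖
      ≤ 2 * |s| ^ (n + 1) / (n + 1).factorial := by
  have key : ∀ φ : ℝ, |Real.cos φ -
      ∑ j ∈ Finset.range (n + 1), Real.cos (s * v j + φ) * weight n v j|
        ≤ |s| ^ (n + 1) / (n + 1).factorial := by
    intro φ
    have := interpolation_error n v hv0 hv hv1
      (fun k t => s ^ k * Real.cos (s * t + φ + k * (Real.pi / 2)))
      (fun k t => by
        have h1 : HasDerivAt (fun t => s * t + φ + k * (Real.pi / 2)) s t := by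
          simpa using (((hasDerivAt_id t).const_mul s).add_const φ).add_const (k * (Real.pi / 2))
        refine (h1.cos.const_mul (s ^ k)).congr_deriv ?_
        push_cast
        rw [show s * t + φ + (k + 1) * (Real.pi / 2)
          = (s * t + φ + k * (Real.pi / 2)) + Real.pi / 2 by ring, Real.cos_add_pi_div_two]
        ring)
      (|s| ^ (n + 1))
      (fun t => by
        rw [abs_mul, abs_pow]
        exact mul_le_of_le_one_right (by positivity) (Real.abs_cos_le_one _))
    simpa using this
  refine (Complex.norm_le_abs_re_add_abs_im _).trans ?_
  have h1 := key 0
  have h2 := key (-(Real.pi / 2))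
  have e1 : (1 - ∑ j ∈ Finset.range (n + 1),
      (weight n v j : ℂ) * Complex.exp ((s * v j : ℝ) * Complex.I)).re =
      Real.cos 0 - ∑ j ∈ Finset.range (n + 1), Real.cos (s * v j + 0) * weight n v j := by
    rw [Complex.sub_re, Complex.re_sum, Real.cos_zero, Complex.one_re]
    congr 1
    refine Finset.sum_congr rfl fun j _ => ?_
    rw [Complex.re_ofReal_mul, Complex.exp_ofReal_mul_I_re, add_zero, mul_comm]
  have e2 : (1 - ∑ j ∈ Finset.range (n + 1),
      (weight n v j : ℂ) * Complex.exp ((s * v j : ℝ) * Complex.I)).im =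
      Real.cos (-(Real.pi / 2)) -
        ∑ j ∈ Finset.range (n + 1), Real.cos (s * v j + -(Real.pi / 2)) * weight n v j := by
    rw [Complex.sub_im, Complex.im_sum, Real.cos_neg, Real.cos_pi_div_two, Complex.one_im]
    congr 1
    refine Finset.sum_congr rfl fun j _ => ?_
    rw [Complex.im_ofReal_mul, Complex.exp_ofReal_mul_I_im, ← sub_eq_add_neg,
      Real.cos_sub_pi_div_two, mul_comm]
  rw [e1, e2]
  calc _ ≤ |s| ^ (n + 1) / (n + 1).factorial + |s| ^ (n + 1) / (n + 1).factorial := add_le_add h1 h2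
    _ = _ := by ring

/-- In the j-th weight the numerators are at most 1, and the gaps |v j - v k| ≥ |j - k|δ multiply to
at least δ^n j!(n-j)!. The resulting bounds are binomial coefficients, which sum to 2^n. -/
theorem sum_abs_weight_le (n : ℕ) (v : ℕ → ℝ) {δ : ℝ} (hδ : 0 < δ) (hv0 : 0 < v 0)
    (hv : ∀ i < n, v i + δ ≤ v (i + 1)) (hv1 : ∀ i ≤ n, v i ≤ 1) :
    ∑ j ∈ Finset.range (n + 1), |weight n v j| ≤ (2 / δ) ^ n / n.factorial := by
  classical
  have hsep : ∀ i j, i ≤ j → j ≤ n → v i + (j - i : ℕ) * δ ≤ v j := by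
    intro i j hij
    induction j, hij using Nat.le_induction with
    | base => intro h; simp
    | succ j hj ih =>
      intro h
      have h1 := ih (by omega)
      have h2 := hv j (by omega)
      rw [Nat.succ_sub hj]
      push_cast
      linarith
  have hpos : ∀ i ≤ n, 0 < v i := fun i hi => by
    have := hsep 0 i (by omega) hi
    have : (0 : ℝ) ≤ (i - 0 : ℕ) * δ := by positivity
    linarith
  have hterm : ∀ j ∈ Finset.range (n + 1), |weight n v j| ≤ (n.choose j) / (δ ^ n * n.factorial) := by
    intro j hj
    have hjn : j ≤ n := by rw [Finset.mem_range] at hj; omega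
    have hsplit : (Finset.range (n + 1)).erase j = Finset.range j ∪ Finset.Ioc j n := by
      ext k
      simp only [Finset.mem_erase, Finset.mem_range, Finset.mem_union, Finset.mem_Ioc]
      omega
    have hdisj : Disjoint (Finset.range j) (Finset.Ioc j n) := by
      rw [Finset.disjoint_left]
      intro k
      simp only [Finset.mem_range, Finset.mem_Ioc]
      omega
    have hfac : ∀ k ∈ (Finset.range (n + 1)).erase j,
        |(Lagrange.basisDivisor (v j) (v k)).eval 0| ≤ 1 / |v j - v k| := by
      intro k hk
      simp only [Finset.mem_erase, Finset.mem_range] at hk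
      have hk0 := hpos k (by omega)
      have hk1 := hv1 k (by omega)
      simp only [Lagrange.basisDivisor, Polynomial.eval_mul, Polynomial.eval_C,
        Polynomial.eval_sub, Polynomial.eval_X, zero_sub, abs_mul, abs_neg, abs_inv,
        abs_of_pos hk0]
      rw [one_div]
      exact mul_le_of_le_one_right (by positivity) hk1
    have hlow : δ ^ n * (j.factorial * (n - j).factorial) ≤
        ∏ k ∈ (Finset.range (n + 1)).erase j, |v j - v k| := by
      rw [hsplit, Finset.prod_union hdisj]
      have a1 : δ ^ j * j.factorial ≤ ∏ k ∈ Finset.range j, |v j - v k| := by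
        have : δ ^ j * (j.factorial : ℝ) = ∏ k ∈ Finset.range j, (δ * (k + 1 : ℕ)) := by
          rw [Finset.prod_mul_distrib, Finset.prod_const, Finset.card_range,
            ← Finset.prod_range_add_one_eq_factorial]
          push_cast
          rfl
        rw [this, ← Finset.prod_range_reflect]
        refine Finset.prod_le_prod (fun _ _ => by positivity) fun k hk => ?_
        rw [Finset.mem_range] at hk
        have := hsep k j hk.le hjn
        rw [show j - 1 - k + 1 = j - k by omega]
        exact le_trans (by linarith) (le_abs_self _)
      have a2 : δ ^ (n - j) * (n - j).factorial ≤ ∏ k ∈ Finset.Ioc j n, |v j - v k| := by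
        have : δ ^ (n - j) * ((n - j).factorial : ℝ) =
            ∏ k ∈ Finset.range (n - j), (δ * (k + 1 : ℕ)) := by
          rw [Finset.prod_mul_distrib, Finset.prod_const, Finset.card_range,
            ← Finset.prod_range_add_one_eq_factorial]
          push_cast
          rfl
        rw [this]
        have h3 : Finset.Ioc j n = Finset.Ico (j + 1) (n + 1) := by
          ext k; simp only [Finset.mem_Ioc, Finset.mem_Ico]; omega
        rw [h3, Finset.prod_Ico_eq_prod_range, show n + 1 - (j + 1) = n - j by omega]
        refine Finset.prod_le_prod (fun _ _ => by positivity) fun k hk => ?_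
        rw [Finset.mem_range] at hk
        have := hsep j (j + 1 + k) (by omega) (by omega)
        rw [show j + 1 + k - j = k + 1 by omega] at this
        rw [abs_sub_comm]
        exact le_trans (by linarith) (le_abs_self _)
      calc δ ^ n * (j.factorial * (n - j).factorial)
          = (δ ^ j * j.factorial) * (δ ^ (n - j) * (n - j).factorial) := by
            rw [show δ ^ n = δ ^ j * δ ^ (n - j) by rw [← pow_add]; congr 1; omega]
            ring
        _ ≤ _ := by gcongr
    have hch : (n.choose j : ℝ) / (δ ^ n * n.factorial)
        = 1 / (δ ^ n * (j.factorial * (n - j).factorial)) := by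
      have := Nat.choose_mul_factorial_mul_factorial hjn
      have h' : (n.choose j : ℝ) * j.factorial * (n - j).factorial = n.factorial := by
        exact_mod_cast this
      have hn0 : (n.factorial : ℝ) ≠ 0 := by positivity
      have hj0 : (j.factorial : ℝ) ≠ 0 := by positivity
      have hnj0 : ((n - j).factorial : ℝ) ≠ 0 := by positivity
      rw [div_eq_div_iff (by positivity) (by positivity), ← h']
      ring
    rw [hch, weight, Lagrange.basis, Polynomial.eval_prod, Finset.abs_prod]
    calc _ ≤ ∏ k ∈ (Finset.range (n + 1)).erase j, 1 / |v j - v k| :=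
          Finset.prod_le_prod (fun _ _ => abs_nonneg _) hfac
      _ = 1 / ∏ k ∈ (Finset.range (n + 1)).erase j, |v j - v k| := by
          rw [Finset.prod_div_distrib, Finset.prod_const_one]
      _ ≤ _ := one_div_le_one_div_of_le (by positivity) hlow
  refine (Finset.sum_le_sum hterm).trans (le_of_eq ?_)
  rw [← Finset.sum_div]
  have : (∑ j ∈ Finset.range (n + 1), (n.choose j : ℝ)) = 2 ^ n := by
    exact_mod_cast Nat.sum_range_choose n
  rw [this, div_pow, div_div]

/-! ### Choice of nodes and of a direction -/

/-- A set of measure larger than `2 n δ` contains `n + 1` points with consecutive gaps `≥ δ`. -/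
theorem exists_separated_points {δ : ℝ} (hδ : 0 < δ) (n : ℕ) : ∀ T : Set ℝ, BddBelow T →
    ENNReal.ofReal (2 * n * δ) < volume T →
    ∃ v : ℕ → ℝ, (∀ i ≤ n, v i ∈ T) ∧ ∀ i < n, v i + δ ≤ v (i + 1) := by
  induction n with
  | zero =>
    intro T _ hT
    have hne : T.Nonempty := by
      by_contra h
      rw [Set.not_nonempty_iff_eq_empty] at h
      simp [h] at hT
    obtain ⟨x, hx⟩ := hne
    exact ⟨fun _ => x, fun _ _ => hx, fun i hi => absurd hi (by omega)⟩
  | succ n ih =>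
    intro T hb hT
    have hne : T.Nonempty := by
      by_contra h
      rw [Set.not_nonempty_iff_eq_empty] at h
      simp [h] at hT
    -- The infimum may be missing from T, so the first point is taken within δ of it. Keeping only
    -- what lies beyond x + δ then discards length at most 2δ.
    obtain ⟨x, hx, hxT⟩ := exists_lt_of_csInf_lt hne (lt_add_of_pos_right (sInf T) hδ)
    have hsub : T ⊆ Set.Icc (sInf T) (sInf T + 2 * δ) ∪ (T ∩ Set.Ici (x + δ)) := by
      intro y hy
      by_cases h : x + δ ≤ y
      · exact Or.inr ⟨hy, h⟩
      · exact Or.inl ⟨csInf_le hb hy, by linarith⟩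
    have hvol : ENNReal.ofReal (2 * n * δ) < volume (T ∩ Set.Ici (x + δ)) := by
      have h1 := (measure_mono hsub).trans (measure_union_le (μ := volume) _ _)
      rw [Real.volume_Icc, add_sub_cancel_left] at h1
      have h2 := lt_of_lt_of_le hT h1
      rw [show 2 * ((n + 1 : ℕ) : ℝ) * δ = 2 * δ + 2 * n * δ by push_cast; ring,
        ENNReal.ofReal_add (by positivity) (by positivity)] at h2
      exact lt_of_add_lt_add_left h2
    obtain ⟨v, hv, hv'⟩ := ih _ (hb.mono Set.inter_subset_left) hvol
    refine ⟨fun i => if i = 0 then x else v (i - 1), fun i hi => ?_, fun i hi => ?_⟩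
    · rcases Nat.eq_zero_or_pos i with rfl | h
      · simpa using hx
      · simpa [h.ne'] using (hv (i - 1) (by omega)).1
    · rcases Nat.eq_zero_or_pos i with rfl | h
      · simpa using (hv 0 (by omega)).2
      · have := hv' (i - 1) (by omega)
        rw [show i - 1 + 1 = i by omega] at this
        simpa [h.ne'] using this

/-- One-dimensional extrapolation to the origin from a set of positive measure, exact up to a
factorially small error on exponentials. -/
theorem exists_nodes_weights (n : ℕ) {T : Set ℝ} (hT : T ⊆ Set.Ioc 0 1) {τ : ℝ} (hτ : 0 < τ)
    (hvol : ENNReal.ofReal τ ≤ volume T) :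
    ∃ v c : ℕ → ℝ, (∀ i ≤ n, v i ∈ T) ∧
      (∑ j ∈ Finset.range (n + 1), |c j| ≤ Real.exp 1 * (4 * Real.exp 1 / τ) ^ n) ∧
      ∀ s : ℝ, ‖1 - ∑ j ∈ Finset.range (n + 1),
        (c j : ℂ) * Complex.exp ((s * v j : ℝ) * Complex.I)‖
          ≤ 2 * |s| ^ (n + 1) / (n + 1).factorial := by
  -- With n+1 instead of n, 2nδ < τ is strict and n = 0 is allowed. The factor (n+1)^n this puts
  -- into the weights is absorbed by n!, at the price of e^(n+1).
  set δ := τ / (2 * (n + 1)) with hδ'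
  have hδ : 0 < δ := by positivity
  obtain ⟨v, hvT, hv⟩ := exists_separated_points hδ n T ⟨0, fun x hx => (hT hx).1.le⟩ (by
    refine lt_of_lt_of_le ?_ hvol
    rw [ENNReal.ofReal_lt_ofReal_iff hτ, hδ']
    rw [show 2 * (n : ℝ) * (τ / (2 * (n + 1))) = τ * (n / (n + 1)) by field_simp]
    refine mul_lt_of_lt_one_right hτ ?_
    rw [div_lt_one (by positivity)]
    linarith)
  refine ⟨v, weight n v, hvT, ?_, ?_⟩
  · refine (sum_abs_weight_le n v hδ (hT (hvT 0 (by omega))).1 hv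
      (fun i hi => (hT (hvT i hi)).2)).trans ?_
    have h1 := Real.pow_div_factorial_le_exp (x := (n + 1 : ℝ)) (by positivity) n
    calc (2 / δ) ^ n / n.factorial = (4 / τ) ^ n * ((n + 1 : ℝ) ^ n / n.factorial) := by
          rw [hδ', show 2 / (τ / (2 * ((n : ℝ) + 1))) = (4 / τ) * (n + 1) by field_simp; norm_num,
            mul_pow]
          ring
      _ ≤ (4 / τ) ^ n * Real.exp (n + 1) := by gcongr
      _ = _ := by
          rw [Real.exp_add, ← Real.exp_one_pow n]
          rw [div_pow, div_pow, mul_pow]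
          ring
  · exact norm_one_sub_sum_exp_le n v (hT (hvT 0 (by omega))).1
      (fun i hi => lt_of_lt_of_le (by linarith) (hv i hi)) (fun i hi => (hT (hvT i hi)).2)

/-- Through a point `x` near `E` there is a segment meeting `E` in a set of large length. -/
theorem exists_direction {d : ℕ} {E : Set (EuclideanSpace ℝ (Fin d))} (hE : MeasurableSet E)
    {x : EuclideanSpace ℝ (Fin d)} {ϱ : ℝ} (hϱ : 0 ≤ ϱ) (hEx : ∀ e ∈ E, ‖e - x‖ ≤ ϱ) {m : ℝ}
    (hm : 0 < m) (hmE : ENNReal.ofReal m ≤ volume E) :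
    ∃ y : EuclideanSpace ℝ (Fin d), ‖y‖ ≤ 2 * ϱ ∧
      ENNReal.ofReal (m / (4 * (volume.real (Metric.closedBall (0 : EuclideanSpace ℝ (Fin d))
        (2 * ϱ)) + 1))) ≤ volume {t : ℝ | t ∈ Set.Icc (1 / 2) 1 ∧ x + t • y ∈ E} := by
  set B := Metric.closedBall (0 : EuclideanSpace ℝ (Fin d)) (2 * ϱ) with hB
  set κ := m / (4 * (volume.real B + 1)) with hκ
  by_contra! hcon
  have hBfin : volume B ≠ ⊤ := measure_closedBall_lt_top.ne
  -- Double counting: for each t in [1/2,1] the admissible y have measure t^(-d)|E| ≥ m, so S has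
  -- measure at least m/2. If every direction were bad, slicing by y would give at most κ|B| ≤ m/4.
  -- Keeping t ≥ 1/2 confines y to B.
  set S : Set (ℝ × EuclideanSpace ℝ (Fin d)) :=
    {p | p.1 ∈ Set.Icc (1 / 2 : ℝ) 1 ∧ x + p.1 • p.2 ∈ E} with hS
  have hSm : MeasurableSet S := by
    refine (measurable_fst measurableSet_Icc).inter ?_
    exact (by fun_prop : Measurable fun p : ℝ × EuclideanSpace ℝ (Fin d) => x + p.1 • p.2) hE
  have hin : ∀ t ∈ Set.Icc (1 / 2 : ℝ) 1, ∀ y, x + t • y ∈ E → ‖y‖ ≤ 2 * ϱ := by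
    intro t ht y hy
    have := hEx _ hy
    rw [add_sub_cancel_left, norm_smul, Real.norm_eq_abs, abs_of_pos (by linarith [ht.1])] at this
    nlinarith [ht.1, norm_nonneg y]
  have hlow : ENNReal.ofReal (m / 2) ≤ ((volume : Measure ℝ).prod volume) S := by
    rw [Measure.prod_apply hSm]
    calc ENNReal.ofReal (m / 2) = ∫⁻ t in Set.Icc (1 / 2 : ℝ) 1, ENNReal.ofReal m := by
          rw [setLIntegral_const, Real.volume_Icc, ← ENNReal.ofReal_mul hm.le]
          congr 1; ring
      _ ≤ ∫⁻ t in Set.Icc (1 / 2 : ℝ) 1, volume (Prod.mk t ⁻¹' S) := by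
          refine setLIntegral_mono' measurableSet_Icc fun t ht => ?_
          have h0 : t ≠ 0 := by linarith [ht.1]
          have : Prod.mk t ⁻¹' S = (t • ·) ⁻¹' ((x + ·) ⁻¹' E) := by
            ext y; simp only [hS, Set.mem_preimage, Set.mem_ofPred_eq]; tauto
          rw [this, Measure.addHaar_preimage_smul _ h0, measure_preimage_add]
          refine hmE.trans ?_
          refine le_mul_of_one_le_left zero_le ?_
          rw [ENNReal.one_le_ofReal, abs_inv, abs_pow, abs_of_pos (by linarith [ht.1])]
          exact (one_le_inv₀ (pow_pos (by linarith [ht.1]) _)).2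
            (pow_le_one₀ (by linarith [ht.1]) ht.2)
      _ ≤ _ := setLIntegral_le_lintegral _ _
  have hup : ((volume : Measure ℝ).prod volume) S ≤ ENNReal.ofReal (m / 4) := by
    rw [Measure.prod_apply_symm hSm]
    calc ∫⁻ y, volume ((fun t => (t, y)) ⁻¹' S)
        ≤ ∫⁻ y, B.indicator (fun _ => ENNReal.ofReal κ) y := by
          refine lintegral_mono fun y => ?_
          by_cases hy : ‖y‖ ≤ 2 * ϱ
          · rw [Set.indicator_of_mem (by simpa [hB] using hy)]
            exact (hcon y hy).le
          · rw [Set.indicator_of_notMem (by simpa [hB] using hy)]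
            have : (fun t => (t, y)) ⁻¹' S = ∅ := by
              ext t
              simp only [hS, Set.mem_preimage, Set.mem_ofPred_eq, Set.mem_empty_iff_false, iff_false]
              exact fun h => hy (hin t h.1 y h.2)
            simp [this]
      _ = ENNReal.ofReal (κ * volume.real B) := by
          rw [lintegral_indicator_const Metric.isClosed_closedBall.measurableSet,
            ENNReal.ofReal_mul (by positivity), ofReal_measureReal hBfin]
      _ ≤ _ := by
          refine ENNReal.ofReal_le_ofReal ?_
          have : 0 ≤ volume.real B := measureReal_nonneg
          rw [hκ, div_mul_eq_mul_div, div_le_div_iff₀ (by positivity) (by norm_num)]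
          nlinarith
  have := hlow.trans hup
  rw [ENNReal.ofReal_le_ofReal_iff (by positivity)] at this
  linarith

/-! ### Fourier identities for integrable functions -/

section Bandlimited

variable {V : Type*} [NormedAddCommGroup V] [InnerProductSpace ℝ V] [FiniteDimensional ℝ V]
  [MeasurableSpace V] [BorelSpace V]

theorem integral_fourier_mul {p q : V → ℂ} (hp : Integrable p) (hq : Integrable q) :
    ∫ x, 𝓕 p x * q x = ∫ x, p x * 𝓕 q x := by
  simpa using! VectorFourier.integral_fourierIntegral_smul_eq_flip (L := innerₗ V)
    Real.continuous_fourierChar continuous_inner hp hq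

theorem integral_fourierInv_mul {p q : V → ℂ} (hp : Integrable p) (hq : Integrable q) :
    ∫ x, 𝓕⁻ p x * q x = ∫ x, p x * 𝓕⁻ q x := by
  have hflip : (-innerₗ V).flip = -innerₗ V := by
    ext x y
    simp [real_inner_comm]
  have := VectorFourier.integral_fourierIntegral_smul_eq_flip (L := -innerₗ V)
    Real.continuous_fourierChar (by simpa using! continuous_inner.neg) hp hq
  rw [hflip] at this
  exact this

theorem continuous_fourier {p : V → ℂ} (hp : Integrable p) : Continuous (𝓕 p) :=
  VectorFourier.fourierIntegral_continuous Real.continuous_fourierChar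
    (by simpa using! continuous_inner) hp

theorem continuous_fourierInv {p : V → ℂ} (hp : Integrable p) : Continuous (𝓕⁻ p) :=
  VectorFourier.fourierIntegral_continuous Real.continuous_fourierChar
    (by simpa using! continuous_inner.neg) hp

theorem norm_fourierInv_le (p : V → ℂ) (x : V) : ‖𝓕⁻ p x‖ ≤ ∫ ξ, ‖p ξ‖ :=
  VectorFourier.norm_fourierIntegral_le_integral_norm _ _ _ _ _

/-- The Fourier transform of a product `𝓕⁻ g * ψ` vanishes off the sum of the supports. -/
theorem fourier_fourierInv_mul_eq_zero {g ψ : V → ℂ} (hg : Integrable g) (hψ : Integrable ψ)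
    {r s : ℝ} (hgr : ∀ ξ, r < ‖ξ‖ → g ξ = 0) (hψs : ∀ ξ, s < ‖ξ‖ → 𝓕 ψ ξ = 0) {ζ : V}
    (hζ : r + s < ‖ζ‖) : 𝓕 (fun x => 𝓕⁻ g x * ψ x) ζ = 0 := by
  -- The character is attached to ψ so that duality can move the inverse transform off g. What
  -- remains is the convolution integral of g(ξ) 𝓕ψ(ζ - ξ), whose integrand vanishes identically.
  have h1 : 𝓕 (fun x => 𝓕⁻ g x * ψ x) ζ
      = ∫ x, 𝓕⁻ g x * (Real.fourierChar (-(inner ℝ x ζ)) • ψ x) := by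
    rw [Real.fourier_eq]
    refine integral_congr_ae (Filter.Eventually.of_forall fun x => ?_)
    simp only [Circle.smul_def, smul_eq_mul]
    ring
  have hq : Integrable (fun x => Real.fourierChar (-(inner ℝ x ζ)) • ψ x) :=
    (Real.fourierIntegral_convergent_iff ζ).2 hψ
  rw [h1, integral_fourierInv_mul hg hq]
  refine integral_eq_zero_of_ae (Filter.Eventually.of_forall fun ξ => ?_)
  by_cases hξ : r < ‖ξ‖
  · simp [hgr ξ hξ]
  · have : 𝓕⁻ (fun x => Real.fourierChar (-(inner ℝ x ζ)) • ψ x) ξ = 𝓕 ψ (ζ - ξ) := by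
      rw [Real.fourierInv_eq, Real.fourier_eq]
      refine integral_congr_ae (Filter.Eventually.of_forall fun x => ?_)
      simp only
      rw [smul_smul, ← AddChar.map_add_eq_mul, inner_sub_right]
      congr 2
      ring
    have hlt : s < ‖ζ - ξ‖ := by
      have := norm_sub_norm_le ζ ξ
      linarith
    simp only [this, hψs _ hlt, mul_zero, Pi.zero_apply]

theorem integrable_of_continuous_of_eq_zero {p : V → ℂ} (hp : Continuous p) {r : ℝ}
    (h : ∀ ξ, r < ‖ξ‖ → p ξ = 0) : Integrable p :=
  hp.integrable_of_hasCompactSupport (HasCompactSupport.intro (isCompact_closedBall 0 r)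
    fun ξ hξ => h ξ (by simpa using hξ))

/-- Plancherel's identity for integrable functions with integrable Fourier transform. -/
theorem integral_norm_sq_fourier {h : V → ℂ} (hc : Continuous h) (hi : Integrable h)
    (hF : Integrable (𝓕 h)) : ∫ ξ, ‖𝓕 h ξ‖ ^ 2 = ∫ x, ‖h x‖ ^ 2 := by
  have hconj : Integrable (fun ξ => (starRingEnd ℂ) (𝓕 h ξ)) :=
    (Complex.conjLIE.toContinuousLinearEquiv.toContinuousLinearMap).integrable_comp hF
  -- Duality is applied to h and the conjugate of 𝓕 h; by inversion, the transform of the latter is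
  -- the conjugate of h.
  have h1 := integral_fourier_mul hi hconj
  have h2 : ∀ x, 𝓕 (fun ξ => (starRingEnd ℂ) (𝓕 h ξ)) x = (starRingEnd ℂ) (h x) := by
    intro x
    have h3 := congrFun (hc.fourierInv_fourier_eq hi hF) x
    rw [← h3, Real.fourierInv_eq, Real.fourier_eq, ← integral_conj]
    refine integral_congr_ae (Filter.Eventually.of_forall fun ξ => ?_)
    simp only [Circle.smul_def, smul_eq_mul, map_mul]
    rw [AddChar.map_neg_eq_inv, Circle.coe_inv_eq_conj]
  simp only [h2, Complex.mul_conj, Complex.normSq_eq_norm_sq] at h1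
  rw [integral_complex_ofReal, integral_complex_ofReal] at h1
  exact_mod_cast h1

/-- Cauchy-Schwarz on a ball. -/
theorem sq_integral_norm_le {p : V → ℂ} (hp : Continuous p) {r : ℝ}
    (h : ∀ ξ, r < ‖ξ‖ → p ξ = 0) :
    (∫ ξ, ‖p ξ‖) ^ 2 ≤ volume.real (Metric.closedBall (0 : V) r) * ∫ ξ, ‖p ξ‖ ^ 2 := by
  set B := Metric.closedBall (0 : V) r with hB
  have hoff : ∀ ξ, ξ ∉ B → p ξ = 0 := fun ξ hξ => h ξ (by simpa [hB] using hξ)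
  have e1 : ∫ ξ, ‖p ξ‖ = ∫ ξ in B, ‖p ξ‖ :=
    (setIntegral_eq_integral_of_forall_compl_eq_zero fun ξ hξ => by simp [hoff ξ hξ]).symm
  have e2 : ∫ ξ, ‖p ξ‖ ^ 2 = ∫ ξ in B, ‖p ξ‖ ^ 2 :=
    (setIntegral_eq_integral_of_forall_compl_eq_zero fun ξ hξ => by simp [hoff ξ hξ]).symm
  rw [e1, e2]
  have hK : IsCompact B := isCompact_closedBall _ _
  have i1 : IntegrableOn (fun ξ => ‖p ξ‖) B := hp.norm.continuousOn.integrableOn_compact hK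
  have i2 : IntegrableOn (fun ξ => ‖p ξ‖ ^ 2) B :=
    (hp.norm.pow 2).continuousOn.integrableOn_compact hK
  have hBfin : volume B ≠ ⊤ := measure_closedBall_lt_top.ne
  set b := volume.real B
  set J := ∫ ξ in B, ‖p ξ‖
  -- This integral expands to b(b∫‖p‖² - J²), so the claim follows on dividing by b; the case b = 0
  -- is separate.
  have key : 0 ≤ ∫ ξ in B, (b * ‖p ξ‖ - J) ^ 2 := integral_nonneg fun _ => sq_nonneg _
  have hc : IntegrableOn (fun _ : V => J ^ 2) B := integrableOn_const hBfin
  have : ∫ ξ in B, (b * ‖p ξ‖ - J) ^ 2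
      = b ^ 2 * (∫ ξ in B, ‖p ξ‖ ^ 2) - 2 * b * J * J + b * J ^ 2 := by
    have e : ∀ ξ, (b * ‖p ξ‖ - J) ^ 2 = b ^ 2 * ‖p ξ‖ ^ 2 - 2 * b * J * ‖p ξ‖ + J ^ 2 := by
      intro ξ; ring
    simp_rw [e]
    have i3 : IntegrableOn (fun ξ => b ^ 2 * ‖p ξ‖ ^ 2 - 2 * b * J * ‖p ξ‖) B :=
      (i2.const_mul _).sub (i1.const_mul _)
    rw [integral_add i3 hc,
      integral_sub (i2.const_mul _) (i1.const_mul _), integral_const_mul, integral_const_mul,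
      setIntegral_const, smul_eq_mul]
  rw [this] at key
  have hb : 0 ≤ b := measureReal_nonneg
  rcases hb.eq_or_lt with hb0 | hb0
  · have : J = 0 := by
      have hz : volume B = 0 := by
        have := (measureReal_eq_zero_iff hBfin).1 hb0.symm
        exact this
      exact setIntegral_measure_zero _ hz
    rw [this, ← hb0]; simp
  · nlinarith [key, hb0]

end Bandlimited

/-! ### Extrapolation and local estimates for band-limited functions -/

section Bandlimited

variable {V : Type*} [NormedAddCommGroup V] [InnerProductSpace ℝ V] [FiniteDimensional ℝ V]
  [MeasurableSpace V] [BorelSpace V]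

/-- Under the Fourier integral, moving by `v j • y` multiplies by an exponential with s = 2π⟨ξ,y⟩,
and |s| ≤ 2πρ‖y‖ wherever p is nonzero. The scalar extrapolation error therefore integrates against
‖p‖. -/
theorem fourierInv_extrapolation {p : V → ℂ} (hp : Integrable p) {ρ : ℝ}
    (hpρ : ∀ ξ, ρ < ‖ξ‖ → p ξ = 0) {n : ℕ} {v c : ℕ → ℝ}
    (hvc : ∀ s : ℝ, ‖1 - ∑ j ∈ Finset.range (n + 1),
      (c j : ℂ) * Complex.exp ((s * v j : ℝ) * Complex.I)‖
        ≤ 2 * |s| ^ (n + 1) / (n + 1).factorial) (x y : V) :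
    ‖𝓕⁻ p x‖ ≤ ∑ j ∈ Finset.range (n + 1), |c j| * ‖𝓕⁻ p (x + v j • y)‖ +
      2 * (2 * Real.pi * (ρ * ‖y‖)) ^ (n + 1) / (n + 1).factorial * ∫ ξ, ‖p ξ‖ := by
  have hint : ∀ z : V, Integrable (fun ξ => Real.fourierChar (inner ℝ ξ z) • p ξ) := by
    intro z
    have := (Real.fourierIntegral_convergent_iff (f := p) (-z)).2 hp
    simpa [inner_neg_right] using this
  have hid : 𝓕⁻ p x - ∑ j ∈ Finset.range (n + 1), (c j : ℂ) * 𝓕⁻ p (x + v j • y) =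
      ∫ ξ, Real.fourierChar (inner ℝ ξ x) • ((1 - ∑ j ∈ Finset.range (n + 1),
        (c j : ℂ) * Complex.exp (((2 * Real.pi * inner ℝ ξ y) * v j : ℝ) * Complex.I)) * p ξ) := by
    simp only [Real.fourierInv_eq]
    simp_rw [← integral_const_mul]
    rw [← integral_finsetSum _ (fun j _ => (hint _).const_mul _),
      ← integral_sub (hint _) (integrable_finsetSum _ fun j _ => (hint _).const_mul _)]
    refine integral_congr_ae (Filter.Eventually.of_forall fun ξ => ?_)
    simp only [Circle.smul_def, smul_eq_mul, inner_add_right, AddChar.map_add_eq_mul,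
      inner_smul_right, Circle.coe_mul, sub_mul, mul_sub, one_mul, Finset.sum_mul, Finset.mul_sum]
    congr 1
    refine Finset.sum_congr rfl fun j _ => ?_
    rw [Real.fourierChar_apply (v j * inner ℝ ξ y)]
    rw [show (2 * Real.pi * (v j * inner ℝ ξ y) : ℝ) = 2 * Real.pi * inner ℝ ξ y * v j by ring]
    ring
  have hbound : ‖𝓕⁻ p x - ∑ j ∈ Finset.range (n + 1), (c j : ℂ) * 𝓕⁻ p (x + v j • y)‖ ≤
      2 * (2 * Real.pi * (ρ * ‖y‖)) ^ (n + 1) / (n + 1).factorial * ∫ ξ, ‖p ξ‖ := by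
    rw [hid, ← integral_const_mul]
    refine norm_integral_le_of_norm_le (hp.norm.const_mul _)
      (Filter.Eventually.of_forall fun ξ => ?_)
    rw [Circle.norm_smul, norm_mul]
    by_cases hξ : ρ < ‖ξ‖
    · simp [hpρ ξ hξ]
    · refine mul_le_mul_of_nonneg_right ((hvc _).trans ?_) (norm_nonneg _)
      have : |2 * Real.pi * inner ℝ ξ y| ≤ 2 * Real.pi * (ρ * ‖y‖) := by
        rw [abs_mul, abs_of_pos (by positivity)]
        have h1 := abs_real_inner_le_norm ξ y
        have h2 : ‖ξ‖ * ‖y‖ ≤ ρ * ‖y‖ :=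
          mul_le_mul_of_nonneg_right (not_lt.1 hξ) (norm_nonneg _)
        have h3 : (0 : ℝ) ≤ 2 * Real.pi := by positivity
        exact mul_le_mul_of_nonneg_left (h1.trans h2) h3
      gcongr
  have h1 : ‖∑ j ∈ Finset.range (n + 1), (c j : ℂ) * 𝓕⁻ p (x + v j • y)‖ ≤
      ∑ j ∈ Finset.range (n + 1), |c j| * ‖𝓕⁻ p (x + v j • y)‖ := by
    refine (norm_sum_le _ _).trans (le_of_eq (Finset.sum_congr rfl fun j _ => ?_))
    rw [norm_mul, Complex.norm_real, Real.norm_eq_abs]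
  have h2 := norm_sub_norm_le (𝓕⁻ p x)
    (∑ j ∈ Finset.range (n + 1), (c j : ℂ) * 𝓕⁻ p (x + v j • y))
  linarith

end Bandlimited

/-- Volume-dependent constant in the choice of a good direction. -/
noncomputable def directionConst (d : ℕ) (ϱ : ℝ) : ℝ :=
  4 * (volume.real (Metric.closedBall (0 : EuclideanSpace ℝ (Fin d)) (2 * ϱ)) + 1)

theorem directionConst_pos (d : ℕ) (ϱ : ℝ) : 0 < directionConst d ϱ := by
  have : 0 ≤ volume.real (Metric.closedBall (0 : EuclideanSpace ℝ (Fin d)) (2 * ϱ)) :=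
    measureReal_nonneg
  unfold directionConst
  positivity

/-- A band-limited function which is `≤ lam` on a set of measure `≥ m` is controlled nearby. -/
theorem norm_fourierInv_le_of_le_on {d : ℕ} {p : EuclideanSpace ℝ (Fin d) → ℂ} (hp : Integrable p)
    {ρ : ℝ} (hρ : 0 ≤ ρ) (hpρ : ∀ ξ, ρ < ‖ξ‖ → p ξ = 0)
    {E : Set (EuclideanSpace ℝ (Fin d))} (hE : MeasurableSet E)
    {x : EuclideanSpace ℝ (Fin d)} {ϱ : ℝ} (hϱ : 0 ≤ ϱ) (hEx : ∀ e ∈ E, ‖e - x‖ ≤ ϱ) {m : ℝ}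
    (hm : 0 < m) (hmE : ENNReal.ofReal m ≤ volume E) {lam : ℝ}
    (hlam : ∀ e ∈ E, ‖𝓕⁻ p e‖ ≤ lam) (n : ℕ) :
    ‖𝓕⁻ p x‖ ≤ Real.exp 1 * (4 * Real.exp 1 * directionConst d ϱ / m) ^ n * lam +
      2 * (4 * Real.pi * ϱ * ρ) ^ (n + 1) / (n + 1).factorial * ∫ ξ, ‖p ξ‖ := by
  obtain ⟨y, hy, hvol⟩ := exists_direction hE hϱ hEx hm hmE
  have hD := directionConst_pos d ϱ
  obtain ⟨v, c, hv, hc, hvc⟩ := exists_nodes_weights n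
    (T := {t : ℝ | t ∈ Set.Icc (1 / 2) 1 ∧ x + t • y ∈ E})
    (fun t ht => ⟨by have := ht.1.1; linarith, ht.1.2⟩) (div_pos hm hD) hvol
  have h0 : 0 ≤ lam := (norm_nonneg _).trans (hlam _ (hv 0 (by omega)).2)
  refine (fourierInv_extrapolation hp hpρ hvc x y).trans (add_le_add ?_ ?_)
  · calc ∑ j ∈ Finset.range (n + 1), |c j| * ‖𝓕⁻ p (x + v j • y)‖
        ≤ ∑ j ∈ Finset.range (n + 1), |c j| * lam := by
          refine Finset.sum_le_sum fun j hj => ?_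
          rw [Finset.mem_range] at hj
          exact mul_le_mul_of_nonneg_left (hlam _ (hv j (by omega)).2) (abs_nonneg _)
      _ ≤ _ := by
          rw [← Finset.sum_mul]
          refine mul_le_mul_of_nonneg_right (hc.trans (le_of_eq ?_)) h0
          rw [div_div_eq_mul_div]
  · refine mul_le_mul_of_nonneg_right ?_ (integral_nonneg fun _ => norm_nonneg _)
    have : 2 * Real.pi * (ρ * ‖y‖) ≤ 4 * Real.pi * ϱ * ρ := by
      have h3 : ρ * ‖y‖ ≤ ρ * (2 * ϱ) := mul_le_mul_of_nonneg_left hy hρ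
      have h4 : (0 : ℝ) ≤ 2 * Real.pi := by positivity
      nlinarith [mul_le_mul_of_nonneg_left h3 h4]
    gcongr

theorem norm_sub_le_of_mem_cube {d : ℕ} {x y : EuclideanSpace ℝ (Fin d)} (hx : x ∈ cube 0 1)
    (hy : y ∈ cube 0 1) : ‖y - x‖ ≤ Real.sqrt d := by
  rw [EuclideanSpace.norm_eq]
  refine Real.sqrt_le_sqrt ?_
  calc ∑ i, ‖(y - x) i‖ ^ 2 ≤ ∑ _i : Fin d, (1 : ℝ) := by
        refine Finset.sum_le_sum fun i _ => ?_
        have h1 := hx i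
        have h2 := hy i
        simp only [PiLp.zero_apply, zero_add, Set.mem_Icc] at h1 h2
        rw [PiLp.sub_apply, Real.norm_eq_abs, sq_abs]
        nlinarith [h1.1, h1.2, h2.1, h2.2]
    _ = d := by simp

theorem measurableSet_cube {d : ℕ} (x : EuclideanSpace ℝ (Fin d)) (a : ℝ) :
    MeasurableSet (cube x a) := by
  have : cube x a = ⋂ i, {y | y i ∈ Set.Icc (x i) (x i + a)} := by
    ext y; simp [cube]
  rw [this]
  exact MeasurableSet.iInter fun i =>
    (by fun_prop : Measurable fun y : EuclideanSpace ℝ (Fin d) => y i) measurableSet_Icc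

theorem volume_cube_zero_one (d : ℕ) :
    volume (cube (0 : EuclideanSpace ℝ (Fin d)) 1) = 1 := by
  have hpre : cube (0 : EuclideanSpace ℝ (Fin d)) 1 =
      (MeasurableEquiv.toLp 2 (Fin d → ℝ)).symm ⁻¹' (Set.univ.pi fun _ => Set.Icc (0 : ℝ) 1) := by
    ext y
    simp [cube, Pi.le_def, forall_and]
  rw [hpre, (EuclideanSpace.volume_preserving_symm_measurableEquiv_toLp (Fin d)).measure_preimage
    (MeasurableSet.univ_pi fun _ => measurableSet_Icc).nullMeasurableSet, volume_pi_pi]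
  simp

/-- Pointwise local estimate on the unit cube. -/
theorem sq_norm_fourierInv_le {d : ℕ} {p : EuclideanSpace ℝ (Fin d) → ℂ} (hp : Integrable p)
    {ρ : ℝ} (hρ : 0 ≤ ρ) (hpρ : ∀ ξ, ρ < ‖ξ‖ → p ξ = 0)
    {ω : Set (EuclideanSpace ℝ (Fin d))} (hω : MeasurableSet ω) {γ : ℝ} (hγ : 0 < γ)
    (hγω : ENNReal.ofReal γ ≤ volume (ω ∩ cube 0 1))
    {x : EuclideanSpace ℝ (Fin d)} (hx : x ∈ cube 0 1) (n : ℕ) :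
    ‖𝓕⁻ p x‖ ^ 2 ≤
      2 * (Real.exp 1 * (8 * Real.exp 1 * directionConst d (Real.sqrt d) / γ) ^ n) ^ 2 *
        (2 / γ * ∫ e in ω ∩ cube 0 1, ‖𝓕⁻ p e‖ ^ 2) +
      2 * (2 * (4 * Real.pi * Real.sqrt d * ρ) ^ (n + 1) / (n + 1).factorial) ^ 2 *
        (∫ ξ, ‖p ξ‖) ^ 2 := by
  set S := ω ∩ cube (0 : EuclideanSpace ℝ (Fin d)) 1 with hS
  have hSm : MeasurableSet S := hω.inter (measurableSet_cube _ _)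
  have hSfin : volume S ≠ ⊤ :=
    ((measure_mono Set.inter_subset_right).trans_lt (by rw [volume_cube_zero_one]; simp)).ne
  have hcont : Continuous (𝓕⁻ p) := continuous_fourierInv hp
  set I := ∫ e in S, ‖𝓕⁻ p e‖ ^ 2 with hI
  have hI0 : 0 ≤ I := integral_nonneg fun _ => by positivity
  have hInt : IntegrableOn (fun e => ‖𝓕⁻ p e‖ ^ 2) S := by
    refine Measure.integrableOn_of_bounded (M := (∫ ξ, ‖p ξ‖) ^ 2) hSfin
      (hcont.norm.pow 2).aestronglyMeasurable (Filter.Eventually.of_forall fun e => ?_)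
    rw [Real.norm_eq_abs, abs_pow, abs_norm]
    exact pow_le_pow_left₀ (norm_nonneg _) (norm_fourierInv_le p e) 2
  set A := Real.exp 1 * (8 * Real.exp 1 * directionConst d (Real.sqrt d) / γ) ^ n with hA
  have hD := directionConst_pos d (Real.sqrt d)
  have hA0 : 0 < A := by positivity
  refine le_of_forall_pos_le_add fun ε hε => ?_
  -- The slack η keeps `lam` positive when I = 0; its size is such that it adds exactly ε to the
  -- final bound.
  set η := ε * γ / (4 * A ^ 2) with hη
  have hη0 : 0 < η := by positivity
  set lam := Real.sqrt (2 / γ * (I + η)) with hlam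
  have hlam2 : lam ^ 2 = 2 / γ * (I + η) := Real.sq_sqrt (by positivity)
  have hlam0 : 0 < lam := Real.sqrt_pos.2 (by positivity)
  set E := S ∩ {e | ‖𝓕⁻ p e‖ ≤ lam} with hE
  have hEm : MeasurableSet E := hSm.inter (isClosed_le hcont.norm continuous_const).measurableSet
  -- Chebyshev: at this level the part of S where the function exceeds `lam` has measure at most
  -- γ/2.
  have hEvol : ENNReal.ofReal (γ / 2) ≤ volume E := by
    have hD1 : volume.real (S \ E) * lam ^ 2 ≤ I := by
      calc volume.real (S \ E) * lam ^ 2 = ∫ e in S \ E, lam ^ 2 := by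
            rw [setIntegral_const, smul_eq_mul]
        _ ≤ ∫ e in S \ E, ‖𝓕⁻ p e‖ ^ 2 := by
            refine setIntegral_mono_on
              (integrableOn_const ((measure_mono Set.sdiff_subset).trans_lt hSfin.lt_top).ne)
              (hInt.mono_set Set.sdiff_subset) (hSm.diff hEm) fun e he => ?_
            have : lam < ‖𝓕⁻ p e‖ := by
              by_contra h
              exact he.2 ⟨he.1, not_lt.1 h⟩
            exact pow_le_pow_left₀ hlam0.le this.le 2
        _ ≤ I := setIntegral_mono_set hInt (Filter.Eventually.of_forall fun _ => by positivity)
            (Filter.Eventually.of_forall Set.sdiff_subset)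
    have hD2 : volume.real (S \ E) ≤ γ / 2 := by
      rw [hlam2] at hD1
      by_contra! h
      have : γ / 2 * (2 / γ * (I + η)) < volume.real (S \ E) * (2 / γ * (I + η)) :=
        mul_lt_mul_of_pos_right h (by positivity)
      have e : γ / 2 * (2 / γ * (I + η)) = I + η := by field_simp
      linarith
    have hsplit : volume.real E + volume.real (S \ E) = volume.real S := by
      have := measureReal_inter_add_sdiff (μ := volume) (s := S) hEm hSfin
      rwa [Set.inter_eq_self_of_subset_right (Set.inter_subset_left : E ⊆ S)] at this
    have hSγ : γ ≤ volume.real S := by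
      rw [measureReal_def]
      exact (ENNReal.ofReal_le_iff_le_toReal hSfin).1 hγω
    have hEfin : volume E ≠ ⊤ := ((measure_mono Set.inter_subset_left).trans_lt hSfin.lt_top).ne
    rw [ENNReal.ofReal_le_iff_le_toReal hEfin, ← measureReal_def]
    linarith
  have key := norm_fourierInv_le_of_le_on hp hρ hpρ hEm (Real.sqrt_nonneg d)
    (fun e he => norm_sub_le_of_mem_cube hx he.1.2) (by positivity) hEvol (fun e he => he.2) n
  rw [show 4 * Real.exp 1 * directionConst d (Real.sqrt d) / (γ / 2)
    = 8 * Real.exp 1 * directionConst d (Real.sqrt d) / γ by field_simp; norm_num, ← hA] at key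
  set R := 2 * (4 * Real.pi * Real.sqrt d * ρ) ^ (n + 1) / (n + 1).factorial
  set J := ∫ ξ, ‖p ξ‖
  calc ‖𝓕⁻ p x‖ ^ 2 ≤ (A * lam + R * J) ^ 2 := pow_le_pow_left₀ (norm_nonneg _) key 2
    _ ≤ 2 * A ^ 2 * lam ^ 2 + 2 * R ^ 2 * J ^ 2 := by nlinarith [sq_nonneg (A * lam - R * J)]
    _ = _ := by
      rw [hlam2, hη]
      field_simp
      ring

/-! ### The window and the localised estimate -/

open scoped ContDiff in
/-- A band-limited window which is bounded below on a ball. -/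
theorem exists_window (d : ℕ) : ∃ ψ : EuclideanSpace ℝ (Fin d) → ℂ, Continuous ψ ∧
    Integrable ψ ∧ (∀ x, ‖ψ x‖ ≤ 1) ∧ (∀ x, ‖x‖ ≤ Real.sqrt d → 1 / 2 ≤ ‖ψ x‖) ∧
    ∀ ξ, 1 < ‖ξ‖ → 𝓕 ψ ξ = 0 := by
  have hD : 0 < 2 * Real.pi * (Real.sqrt d + 1) := by positivity
  -- ψ is the inverse transform of a normalised bump of radius s. This s gives |2π⟨ξ,x⟩| ≤ 1 for ‖ξ‖
  -- ≤ s and ‖x‖ ≤ √d, so the cosine in Re ψ is at least 1/2.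
  set s : ℝ := 1 / (2 * Real.pi * (Real.sqrt d + 1)) with hs
  have hs0 : 0 < s := by positivity
  have hs1 : s ≤ 1 := by
    rw [hs, div_le_one hD]
    have := Real.pi_gt_three
    have := Real.sqrt_nonneg d
    nlinarith
  let φ : ContDiffBump (0 : EuclideanSpace ℝ (Fin d)) := ⟨s / 2, s, by positivity, by linarith⟩
  set χ : EuclideanSpace ℝ (Fin d) → ℂ := fun x => (φ.normed volume x : ℂ) with hχ
  have hsm : ContDiff ℝ ∞ χ := Complex.ofRealCLM.contDiff.comp φ.contDiff_normed
  have hcs : HasCompactSupport χ := φ.hasCompactSupport_normed.comp_left Complex.ofReal_zero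
  let X : SchwartzMap (EuclideanSpace ℝ (Fin d)) ℂ := hcs.toSchwartzMap hsm
  have hX : (X : EuclideanSpace ℝ (Fin d) → ℂ) = χ := rfl
  have hψ : ((𝓕⁻ X : SchwartzMap (EuclideanSpace ℝ (Fin d)) ℂ) : EuclideanSpace ℝ (Fin d) → ℂ)
      = 𝓕⁻ χ := by rw [SchwartzMap.fourierInv_coe, hX]
  have hχi : Integrable χ := by rw [← hX]; exact X.integrable
  have hψi : Integrable (𝓕⁻ χ) := by rw [← hψ]; exact (𝓕⁻ X).integrable
  have hFψ : 𝓕 (𝓕⁻ χ) = χ := by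
    rw [← hψ, ← SchwartzMap.fourier_coe, FourierTransform.fourier_fourierInv_eq, hX]
  have hzero : ∀ ξ, s ≤ ‖ξ‖ → φ.normed volume ξ = 0 := by
    intro ξ hξ
    have := φ.support_normed_eq (μ := volume)
    by_contra h
    have h2 : ξ ∈ Function.support (φ.normed volume) := h
    rw [this] at h2
    have : ‖ξ‖ < s := by simpa using h2
    linarith
  refine ⟨𝓕⁻ χ, continuous_fourierInv hχi, hψi, fun x => ?_, fun x hx => ?_, fun ξ hξ => ?_⟩
  · refine (norm_fourierInv_le χ x).trans (le_of_eq ?_)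
    rw [← φ.integral_normed (μ := volume)]
    refine integral_congr_ae (Filter.Eventually.of_forall fun ξ => ?_)
    simp only [hχ, Complex.norm_real, Real.norm_eq_abs, abs_of_nonneg (φ.nonneg_normed ξ)]
  · refine le_trans ?_ (Complex.re_le_norm _)
    have hi : Integrable (fun ξ => Real.fourierChar (inner ℝ ξ x) • χ ξ) := by
      have := (Real.fourierIntegral_convergent_iff (f := χ) (-x)).2 hχi
      simpa [inner_neg_right] using this
    have hre : (𝓕⁻ χ x).re = ∫ ξ, (Real.fourierChar (inner ℝ ξ x) • χ ξ).re := by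
      rw [Real.fourierInv_eq]
      exact (integral_re hi).symm
    rw [hre]
    calc (1 / 2 : ℝ) = ∫ ξ, 1 / 2 * φ.normed volume ξ := by
          rw [integral_const_mul, φ.integral_normed, mul_one]
      _ ≤ _ := by
          refine integral_mono (φ.integrable_normed.const_mul _) hi.re fun ξ => ?_
          change 1 / 2 * φ.normed volume ξ ≤ (Real.fourierChar (inner ℝ ξ x) • χ ξ).re
          rw [Circle.smul_def, smul_eq_mul, hχ, Complex.re_mul_ofReal, Real.fourierChar_apply,
            Complex.exp_ofReal_mul_I_re]
          by_cases hξ : s ≤ ‖ξ‖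
          · simp [hzero ξ hξ]
          · refine mul_le_mul_of_nonneg_right ?_ (φ.nonneg_normed ξ)
            have h1 : |2 * Real.pi * inner ℝ ξ x| ≤ 1 := by
              rw [abs_mul, abs_of_pos (by positivity)]
              have h2 : |inner ℝ ξ x| ≤ s * (Real.sqrt d + 1) :=
                (abs_real_inner_le_norm ξ x).trans (mul_le_mul (by linarith) (by linarith)
                  (norm_nonneg _) hs0.le)
              calc 2 * Real.pi * |inner ℝ ξ x| ≤ 2 * Real.pi * (s * (Real.sqrt d + 1)) :=
                    mul_le_mul_of_nonneg_left h2 (by positivity)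
                _ = 1 := by rw [hs]; field_simp
            have h3 := Real.one_sub_sq_div_two_le_cos (x := 2 * Real.pi * inner ℝ ξ x)
            have h4 : (2 * Real.pi * inner ℝ ξ x) ^ 2 ≤ 1 := by
              rw [← sq_abs]; exact pow_le_one₀ (abs_nonneg _) h1
            linarith
  · rw [hFψ, hχ]
    simp [hzero ξ (by linarith)]

/-- Local estimate on the unit cube, with a small global error. -/
theorem lintegral_cube_le {d : ℕ} {ψ : EuclideanSpace ℝ (Fin d) → ℂ} (hψc : Continuous ψ)
    (hψi : Integrable ψ) (hψ1 : ∀ x, ‖ψ x‖ ≤ 1) (hψ2 : ∀ x, ‖x‖ ≤ Real.sqrt d → 1 / 2 ≤ ‖ψ x‖)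
    (hψF : ∀ ξ, 1 < ‖ξ‖ → 𝓕 ψ ξ = 0)
    {g : EuclideanSpace ℝ (Fin d) → ℂ} (hg : Integrable g) {r : ℝ} (hr : 0 ≤ r)
    (hgr : ∀ ξ, r < ‖ξ‖ → g ξ = 0)
    {ω : Set (EuclideanSpace ℝ (Fin d))} (hω : MeasurableSet ω) {γ : ℝ} (hγ : 0 < γ)
    (hγω : ENNReal.ofReal γ ≤ volume (ω ∩ cube 0 1)) (n : ℕ) :
    ∫⁻ x in cube 0 1, ‖𝓕⁻ g x‖ₑ ^ 2 ≤
      ENNReal.ofReal (16 / γ *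
        (Real.exp 1 * (8 * Real.exp 1 * directionConst d (Real.sqrt d) / γ) ^ n) ^ 2) *
        (∫⁻ x in ω ∩ cube 0 1, ‖𝓕⁻ g x‖ₑ ^ 2) +
      ENNReal.ofReal (32 * volume.real (Metric.closedBall (0 : EuclideanSpace ℝ (Fin d)) (r + 1)) *
        ((4 * Real.pi * Real.sqrt d * (r + 1)) ^ (n + 1) / (n + 1).factorial) ^ 2) *
        ∫⁻ x, ‖𝓕⁻ g x‖ₑ ^ 2 * ‖ψ x‖ₑ ^ 2 := by
  set f := 𝓕⁻ g with hf
  have hfc : Continuous f := continuous_fourierInv hg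
  -- The window enlarges the spectral radius only to r+1, while the L¹ norm of the spectrum of h is
  -- controlled by ‖h‖₂, which is concentrated near the cube.
  set h : EuclideanSpace ℝ (Fin d) → ℂ := fun x => f x * ψ x with hh
  have hhc : Continuous h := hfc.mul hψc
  have hhi : Integrable h := hψi.bdd_mul hfc.aestronglyMeasurable
    (Filter.Eventually.of_forall fun x => norm_fourierInv_le g x)
  set p := 𝓕 h with hp
  have hpc : Continuous p := continuous_fourier hhi
  have hp0 : ∀ ξ, r + 1 < ‖ξ‖ → p ξ = 0 := fun ξ hξ =>
    fourier_fourierInv_mul_eq_zero hg hψi hgr hψF hξ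
  have hpi : Integrable p := integrable_of_continuous_of_eq_zero hpc hp0
  have hinv : 𝓕⁻ p = h := hhc.fourierInv_fourier_eq hhi hpi
  have hPl : ∫ ξ, ‖p ξ‖ ^ 2 = ∫ x, ‖h x‖ ^ 2 := integral_norm_sq_fourier hhc hhi hpi
  have hCS := sq_integral_norm_le hpc hp0
  rw [hPl] at hCS
  set b := volume.real (Metric.closedBall (0 : EuclideanSpace ℝ (Fin d)) (r + 1)) with hb
  have hb0 : 0 ≤ b := measureReal_nonneg
  set A := Real.exp 1 * (8 * Real.exp 1 * directionConst d (Real.sqrt d) / γ) ^ n with hA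
  set Rf := (4 * Real.pi * Real.sqrt d * (r + 1)) ^ (n + 1) / (n + 1).factorial with hRf
  set S := ω ∩ cube (0 : EuclideanSpace ℝ (Fin d)) 1 with hS
  set I := ∫ e in S, ‖h e‖ ^ 2 with hI
  set H := ∫ x, ‖h x‖ ^ 2 with hH
  have hI0 : 0 ≤ I := integral_nonneg fun _ => by positivity
  have hH0 : 0 ≤ H := integral_nonneg fun _ => by positivity
  have hsqi : Integrable (fun x => ‖h x‖ ^ 2) := by
    have hbd : ∀ x, ‖h x‖ ≤ ∫ ξ, ‖p ξ‖ := fun x => by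
      rw [← hinv]; exact norm_fourierInv_le p x
    have := hhi.norm.bdd_mul (f := fun x => ‖h x‖) hhc.norm.aestronglyMeasurable
      (Filter.Eventually.of_forall fun x => by rw [norm_norm]; exact hbd x)
    simpa [sq] using this
  have hsq : ∀ z : ℂ, ENNReal.ofReal (‖z‖ ^ 2) = ‖z‖ₑ ^ 2 := fun z => by
    rw [ENNReal.ofReal_pow (norm_nonneg _), ofReal_norm]
  have hIe : ENNReal.ofReal I ≤ ∫⁻ x in S, ‖f x‖ₑ ^ 2 := by
    rw [hI, ofReal_integral_eq_lintegral_ofReal hsqi.integrableOn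
      (Filter.Eventually.of_forall fun _ => by positivity)]
    refine lintegral_mono fun x => ?_
    rw [← hsq]
    refine ENNReal.ofReal_le_ofReal (pow_le_pow_left₀ (norm_nonneg _) ?_ 2)
    rw [hh, norm_mul]
    exact mul_le_of_le_one_right (norm_nonneg _) (hψ1 x)
  have hHe : ENNReal.ofReal H = ∫⁻ x, ‖f x‖ₑ ^ 2 * ‖ψ x‖ₑ ^ 2 := by
    rw [hH, ofReal_integral_eq_lintegral_ofReal hsqi
      (Filter.Eventually.of_forall fun _ => by positivity)]
    refine lintegral_congr fun x => ?_
    rw [hsq, hh, enorm_mul, mul_pow]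
  have h0 : (0 : EuclideanSpace ℝ (Fin d)) ∈ cube 0 1 := fun i => by simp
  have hpt : ∀ x ∈ cube (0 : EuclideanSpace ℝ (Fin d)) 1,
      ‖f x‖ ^ 2 ≤ 16 / γ * A ^ 2 * I + 32 * b * Rf ^ 2 * H := by
    intro x hx
    have h1 := sq_norm_fourierInv_le hpi (by positivity) hp0 hω hγ hγω hx n
    rw [hinv] at h1
    have h2 : 1 / 2 ≤ ‖ψ x‖ := hψ2 x (by simpa using norm_sub_le_of_mem_cube h0 hx)
    have h3 : ‖f x‖ ^ 2 ≤ 4 * ‖h x‖ ^ 2 := by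
      have : ‖f x‖ ≤ 2 * ‖h x‖ := by
        rw [hh, norm_mul]
        nlinarith [norm_nonneg (f x)]
      nlinarith [norm_nonneg (f x), norm_nonneg (h x)]
    refine h3.trans ?_
    have h4 : 2 * (2 * (4 * Real.pi * Real.sqrt d * (r + 1)) ^ (n + 1) / (n + 1).factorial) ^ 2 *
        (∫ ξ, ‖p ξ‖) ^ 2 ≤ 8 * b * Rf ^ 2 * H := by
      rw [mul_div_assoc, ← hRf]
      nlinarith [mul_le_mul_of_nonneg_left hCS (sq_nonneg Rf)]
    calc 4 * ‖h x‖ ^ 2 ≤ 4 * (2 * A ^ 2 * (2 / γ * I) + 8 * b * Rf ^ 2 * H) := by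
          refine mul_le_mul_of_nonneg_left (h1.trans ?_) (by norm_num)
          exact add_le_add le_rfl h4
      _ = _ := by ring
  calc ∫⁻ x in cube 0 1, ‖f x‖ₑ ^ 2
      ≤ ∫⁻ x in cube (0 : EuclideanSpace ℝ (Fin d)) 1,
          ENNReal.ofReal (16 / γ * A ^ 2 * I + 32 * b * Rf ^ 2 * H) := by
        refine setLIntegral_mono' (measurableSet_cube _ _) fun x hx => ?_
        rw [← hsq]
        exact ENNReal.ofReal_le_ofReal (hpt x hx)
    _ = ENNReal.ofReal (16 / γ * A ^ 2) * ENNReal.ofReal I +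
          ENNReal.ofReal (32 * b * Rf ^ 2) * ENNReal.ofReal H := by
        rw [setLIntegral_const, volume_cube_zero_one, mul_one,
          ENNReal.ofReal_add (by positivity) (by positivity), ENNReal.ofReal_mul (p := 16 / γ * A ^ 2) (by positivity),
          ENNReal.ofReal_mul (p := 32 * b * Rf ^ 2) (by positivity)]
    _ ≤ _ := by
        rw [hHe]
        exact add_le_add (mul_le_mul' le_rfl hIe) le_rfl

/-! ### Rescaling and averaging over translates -/

/-- Translation modulates the spectrum and dilation by `a` stretches it, which reduces every cube to
the unit cube with spectral radius ar. -/
theorem exists_fourierInv_comp_affine {d : ℕ} {g : EuclideanSpace ℝ (Fin d) → ℂ}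
    (hg : Integrable g) {r : ℝ} (hgr : ∀ ξ, r < ‖ξ‖ → g ξ = 0) {a : ℝ} (ha : 0 < a)
    (c : EuclideanSpace ℝ (Fin d)) :
    ∃ g' : EuclideanSpace ℝ (Fin d) → ℂ, Integrable g' ∧ (∀ ξ, a * r < ‖ξ‖ → g' ξ = 0) ∧
      ∀ x, 𝓕⁻ g (c + a • x) = 𝓕⁻ g' x := by
  have hgc : Integrable (fun ξ => Real.fourierChar (inner ℝ ξ c) • g ξ) := by
    have := (Real.fourierIntegral_convergent_iff (f := g) (-c)).2 hg
    simpa [inner_neg_right] using this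
  set u := fun ξ => Real.fourierChar (inner ℝ ξ c) • g ξ with hu
  refine ⟨fun η => ((a ^ d)⁻¹ : ℝ) • u (a⁻¹ • η), ?_, fun ξ hξ => ?_, fun x => ?_⟩
  · exact (hgc.comp_smul (inv_ne_zero ha.ne')).smul ((a ^ d)⁻¹ : ℝ)
  · have : r < ‖a⁻¹ • ξ‖ := by
      rw [norm_smul, Real.norm_eq_abs, abs_of_pos (inv_pos.2 ha), inv_mul_eq_div, lt_div_iff₀ ha]
      linarith
    simp [hu, hgr _ this]
  · rw [Real.fourierInv_eq, Real.fourierInv_eq]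
    have h := Measure.integral_comp_smul (volume : Measure (EuclideanSpace ℝ (Fin d)))
      (fun ξ => Real.fourierChar (inner ℝ ξ (c + a • x)) • g ξ) a⁻¹
    have had : (0 : ℝ) < a ^ d := by positivity
    rw [finrank_euclideanSpace_fin, inv_pow, inv_inv, abs_of_pos had] at h
    have h2 : ∀ η, Real.fourierChar (inner ℝ η x) • (((a ^ d)⁻¹ : ℝ) • u (a⁻¹ • η)) =
        ((a ^ d)⁻¹ : ℝ) • (Real.fourierChar (inner ℝ (a⁻¹ • η) (c + a • x)) • g (a⁻¹ • η)) := by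
      intro η
      rw [hu, smul_comm]
      congr 1
      rw [smul_smul, ← AddChar.map_add_eq_mul, inner_add_right, inner_smul_left, inner_smul_left,
        inner_smul_right]
      congr 2
      simp only [conj_trivial]
      field_simp
      ring
    simp_rw [h2]
    rw [integral_smul, h, smul_smul, inv_mul_cancel₀ had.ne', one_smul]

theorem volume_preimage_affine_inter_cube {d : ℕ} {γ a : ℝ} (ha : 0 < a)
    {ω : Set (EuclideanSpace ℝ (Fin d))} (hth : IsThick γ a ω) (c : EuclideanSpace ℝ (Fin d)) :
    ENNReal.ofReal γ ≤ volume ((fun x => c + a • x) ⁻¹' ω ∩ cube 0 1) := by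
  have hset : (fun x => c + a • x) ⁻¹' ω ∩ cube 0 1
      = (a • ·) ⁻¹' ((c + ·) ⁻¹' (ω ∩ cube c a)) := by
    ext x
    simp only [Set.mem_inter_iff, Set.mem_preimage]
    refine and_congr Iff.rfl ?_
    simp only [cube, Set.mem_ofPred_eq, Set.mem_Icc, PiLp.zero_apply, zero_add, PiLp.add_apply,
      PiLp.smul_apply, smul_eq_mul, le_add_iff_nonneg_right, add_le_add_iff_left]
    refine forall_congr' fun i => and_congr ?_ ?_
    · exact (mul_nonneg_iff_of_pos_left ha).symm
    · constructor
      · intro h; nlinarith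
      · intro h; exact le_of_mul_le_mul_left (by linarith) ha
  rw [hset, Measure.addHaar_preimage_smul _ ha.ne', measure_preimage_add,
    finrank_euclideanSpace_fin]
  have had : (0 : ℝ) < a ^ d := by positivity
  calc ENNReal.ofReal γ = ENNReal.ofReal |(a ^ d)⁻¹| * ENNReal.ofReal (γ * a ^ d) := by
        rw [← ENNReal.ofReal_mul (abs_nonneg _), abs_of_pos (inv_pos.2 had)]
        congr 1
        field_simp
    _ ≤ _ := mul_le_mul' le_rfl (hth c)

/-- Tonelli and translation invariance in c. Averaging over all positions replaces a tiling by cubes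
and treats the cube terms and the window term alike. -/
theorem lintegral_lintegral_affine {d : ℕ} (μ : Measure (EuclideanSpace ℝ (Fin d))) [SFinite μ]
    {G w : EuclideanSpace ℝ (Fin d) → ENNReal} (hG : Measurable G) (hw : Measurable w) (a : ℝ) :
    ∫⁻ c, ∫⁻ x, G (c + a • x) * w x ∂μ = (∫⁻ x, G x) * ∫⁻ x, w x ∂μ := by
  rw [lintegral_lintegral_swap (by fun_prop)]
  rw [← lintegral_const_mul _ hw]
  refine lintegral_congr fun x => ?_
  rw [lintegral_mul_const _ (by fun_prop), lintegral_add_right_eq_self]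

/-! ### Choice of the degree and absorption of the error -/

/-- Since (eβρ)^(n+1)/(n+1)! ≤ exp(eβρ), the squared factor gains e^(-2(n+1)). This beats ρ^d ≤ d!
e^ρ, M d! ≤ exp(M d! ρ) and exp(2eβρ); the three summands of the witness match these exponents. -/
theorem exists_degree_const (M β : ℝ) (hM : 0 ≤ M) (hβ : 0 ≤ β) (d : ℕ) :
    ∃ K : ℝ, 0 ≤ K ∧ ∀ ρ : ℝ, 1 ≤ ρ → ∀ n : ℕ, K * ρ ≤ n →
      M * ρ ^ d * ((β * ρ) ^ (n + 1) / (n + 1).factorial) ^ 2 ≤ 1 := by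
  refine ⟨M * d.factorial + 1 + 2 * (Real.exp 1 * β), by positivity, fun ρ hρ n hn => ?_⟩
  have h0 : 0 ≤ ρ := by linarith
  have h1 : (β * ρ) ^ (n + 1) / (n + 1).factorial ≤
      Real.exp (Real.exp 1 * (β * ρ) - (n + 1 : ℕ)) := by
    have := Real.pow_div_factorial_le_exp (x := Real.exp 1 * (β * ρ)) (by positivity) (n + 1)
    rw [mul_pow, Real.exp_one_pow, mul_div_assoc] at this
    rw [Real.exp_sub, le_div_iff₀ (Real.exp_pos _)]
    linarith
  have h2 : ρ ^ d ≤ d.factorial * Real.exp ρ := by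
    have := Real.pow_div_factorial_le_exp (x := ρ) h0 d
    rwa [div_le_iff₀' (by positivity)] at this
  have h3 : M * d.factorial ≤ Real.exp (M * d.factorial * ρ) := by
    have := Real.add_one_le_exp (M * d.factorial * ρ)
    have : M * d.factorial * 1 ≤ M * d.factorial * ρ := by gcongr
    linarith
  calc M * ρ ^ d * ((β * ρ) ^ (n + 1) / (n + 1).factorial) ^ 2
      ≤ M * (d.factorial * Real.exp ρ) *
          (Real.exp (Real.exp 1 * (β * ρ) - (n + 1 : ℕ))) ^ 2 := by gcongr
    _ = M * d.factorial * (Real.exp ρ * (Real.exp (Real.exp 1 * (β * ρ) - (n + 1 : ℕ))) ^ 2) := by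
        ring
    _ ≤ Real.exp (M * d.factorial * ρ) *
          (Real.exp ρ * (Real.exp (Real.exp 1 * (β * ρ) - (n + 1 : ℕ))) ^ 2) := by gcongr
    _ = Real.exp (M * d.factorial * ρ + (ρ + 2 * (Real.exp 1 * (β * ρ) - (n + 1 : ℕ)))) := by
        rw [Real.exp_add, Real.exp_add ρ, ← Real.exp_nat_mul]
        push_cast
        rfl
    _ ≤ 1 := by
        rw [Real.exp_le_one_iff]
        push_cast
        have : (0 : ℝ) ≤ n := by positivity
        nlinarith

theorem exists_power_const (D K : ℝ) (hD : 0 < D) (hK : 0 ≤ K) :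
    ∃ C : ℝ, 0 < C ∧ ∀ γ : ℝ, 0 < γ → γ ≤ 1 → ∀ s : ℝ, 0 ≤ s → ∀ n : ℕ, n ≤ K * (s + 1) + 1 →
      2 * (16 / γ * (Real.exp 1 * (8 * Real.exp 1 * D / γ) ^ n) ^ 2) ≤
        ((C / γ) ^ (C * (s + 1))) ^ 2 := by
  -- The summands dominate, in turn, the prefactor, the base and the exponent. In K + 2, one unit
  -- pays for rounding n up and one for the extra power of C/γ that absorbs the prefactor.
  set C := 32 * Real.exp 1 ^ 2 + 8 * Real.exp 1 * D + (K + 2) + 1 with hC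
  have he : 0 < Real.exp 1 := Real.exp_pos 1
  have hC0 : 0 < C := by positivity
  refine ⟨C, hC0, fun γ hγ hγ1 s hs n hn => ?_⟩
  have hX1 : 1 ≤ C / γ := by
    rw [le_div_iff₀ hγ]
    have : 1 ≤ C := by rw [hC]; nlinarith [mul_pos he hD, sq_nonneg (Real.exp 1)]
    linarith
  have h1 : 32 * Real.exp 1 ^ 2 / γ ≤ C / γ := by
    gcongr; rw [hC]; nlinarith [mul_pos he hD]
  have h2 : 8 * Real.exp 1 * D / γ ≤ C / γ := by
    gcongr; rw [hC]; nlinarith [sq_nonneg (Real.exp 1)]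
  have h3 : (C / γ) ^ (n + 1) ≤ (C / γ) ^ (C * (s + 1)) := by
    rw [← Real.rpow_natCast]
    refine Real.rpow_le_rpow_of_exponent_le hX1 ?_
    have : K + 2 ≤ C := by rw [hC]; nlinarith [mul_pos he hD, sq_nonneg (Real.exp 1)]
    push_cast
    nlinarith
  have hX0 : 0 ≤ C / γ := by linarith
  calc 2 * (16 / γ * (Real.exp 1 * (8 * Real.exp 1 * D / γ) ^ n) ^ 2)
      = 32 * Real.exp 1 ^ 2 / γ * ((8 * Real.exp 1 * D / γ) ^ n) ^ 2 := by ring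
    _ ≤ C / γ * ((C / γ) ^ n) ^ 2 := by gcongr
    _ ≤ (C / γ) ^ 2 * ((C / γ) ^ n) ^ 2 := by
        gcongr
        nlinarith
    _ = ((C / γ) ^ (n + 1)) ^ 2 := by rw [pow_succ (C / γ) n]; ring
    _ ≤ _ := by gcongr

theorem exists_const_lintegral_le (d : ℕ) :
    ∃ C : ℝ, 0 < C ∧ ∀ γ : ℝ, 0 < γ → γ ≤ 1 → ∀ a : ℝ, 0 < a →
      ∀ ω : Set (EuclideanSpace ℝ (Fin d)), MeasurableSet ω → IsThick γ a ω →
      ∀ r : ℝ, 0 ≤ r → ∀ g : EuclideanSpace ℝ (Fin d) → ℂ, Integrable g →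
        (∀ ξ, r < ‖ξ‖ → g ξ = 0) → ∫⁻ x, ‖𝓕⁻ g x‖ₑ ^ 2 ≠ ⊤ →
        ∫⁻ x, ‖𝓕⁻ g x‖ₑ ^ 2 ≤
          ENNReal.ofReal (((C / γ) ^ (C * (a * r + 1))) ^ 2) * ∫⁻ x in ω, ‖𝓕⁻ g x‖ₑ ^ 2 := by
  obtain ⟨ψ, hψc, hψi, hψ1, hψ2, hψF⟩ := exists_window d
  have hψfin : ∫⁻ x, ‖ψ x‖ₑ ^ 2 ≠ ⊤ := by
    refine (lt_of_le_of_lt (lintegral_mono fun x => ?_) hψi.2).ne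
    have : ‖ψ x‖ₑ ≤ 1 := by
      rw [← ofReal_norm]; exact ENNReal.ofReal_le_one.2 (hψ1 x)
    calc ‖ψ x‖ₑ ^ 2 = ‖ψ x‖ₑ * ‖ψ x‖ₑ := sq _
      _ ≤ ‖ψ x‖ₑ * 1 := by gcongr
      _ = _ := mul_one _
  set P := (∫⁻ x, ‖ψ x‖ₑ ^ 2).toReal with hP
  set v := volume.real (Metric.closedBall (0 : EuclideanSpace ℝ (Fin d)) 1) with hv
  have hv0 : 0 ≤ v := measureReal_nonneg
  have hP0 : 0 ≤ P := ENNReal.toReal_nonneg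
  -- Using 64, twice the 32 of the local estimate, brings the averaged error down to 1/2, so it can
  -- be absorbed in the finite left-hand side.
  obtain ⟨K, hK0, hK⟩ := exists_degree_const (64 * v * P) (4 * Real.pi * Real.sqrt d)
    (by positivity) (by positivity) d
  obtain ⟨C, hC0, hC⟩ := exists_power_const (directionConst d (Real.sqrt d)) K
    (directionConst_pos _ _) hK0
  refine ⟨C, hC0, fun γ hγ hγ1 a ha ω hω hth r hr g hg hgr hfin => ?_⟩
  have har : 0 ≤ a * r := by positivity
  set n := ⌈K * (a * r + 1)⌉₊ with hn
  have hn1 : K * (a * r + 1) ≤ n := Nat.le_ceil _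
  have hn2 : (n : ℝ) ≤ K * (a * r + 1) + 1 := (Nat.ceil_lt_add_one (by positivity)).le
  set F := 𝓕⁻ g with hF
  have hFc : Continuous F := continuous_fourierInv hg
  set Λ := 16 / γ *
    (Real.exp 1 * (8 * Real.exp 1 * directionConst d (Real.sqrt d) / γ) ^ n) ^ 2 with hΛ
  set ε := 32 * volume.real (Metric.closedBall (0 : EuclideanSpace ℝ (Fin d)) (a * r + 1)) *
    ((4 * Real.pi * Real.sqrt d * (a * r + 1)) ^ (n + 1) / (n + 1).factorial) ^ 2 with hε
  have hε0 : 0 ≤ ε := by positivity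
  have hεP : ε * P ≤ 1 / 2 := by
    have hvol : volume.real (Metric.closedBall (0 : EuclideanSpace ℝ (Fin d)) (a * r + 1)) =
        (a * r + 1) ^ d * v := by
      rw [hv, measureReal_def, Measure.addHaar_closedBall' _ _ (by positivity),
        finrank_euclideanSpace_fin, ENNReal.toReal_mul, ENNReal.toReal_ofReal (by positivity)]
      rfl
    have := hK (a * r + 1) (by linarith) n hn1
    rw [hε, hvol]
    nlinarith
  -- The factors `* 1` are constant weights, put there to fit `lintegral_lintegral_affine`.
  have hloc : ∀ c : EuclideanSpace ℝ (Fin d),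
      ∫⁻ x in cube 0 1, ‖F (c + a • x)‖ₑ ^ 2 * 1 ≤
        ENNReal.ofReal Λ *
          (∫⁻ x in cube 0 1, ω.indicator (fun y => ‖F y‖ₑ ^ 2) (c + a • x) * 1) +
        ENNReal.ofReal ε * ∫⁻ x, ‖F (c + a • x)‖ₑ ^ 2 * ‖ψ x‖ₑ ^ 2 := by
    intro c
    obtain ⟨g', hg', hgr', heq⟩ := exists_fourierInv_comp_affine hg hgr ha c
    have hmeas : Measurable fun x : EuclideanSpace ℝ (Fin d) => c + a • x := by fun_prop
    have := lintegral_cube_le hψc hψi hψ1 hψ2 hψF hg' har hgr' (hmeas hω) hγ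
      (volume_preimage_affine_inter_cube ha hth c) n
    simp_rw [← heq] at this
    simp only [mul_one]
    refine this.trans (add_le_add (mul_le_mul' le_rfl (le_of_eq ?_)) le_rfl)
    rw [← Measure.restrict_restrict (hmeas hω), ← lintegral_indicator (hmeas hω)]
    rfl
  have hFm : Measurable fun x => ‖F x‖ₑ ^ 2 := (hFc.enorm.measurable).pow_const 2
  have hψm : Measurable fun x => ‖ψ x‖ₑ ^ 2 := (hψc.enorm.measurable).pow_const 2
  have hint := lintegral_mono (μ := (volume : Measure (EuclideanSpace ℝ (Fin d)))) hloc
  have hind : Measurable (ω.indicator (fun y => ‖F y‖ₑ ^ 2)) := hFm.indicator hω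
  have hm1 : Measurable fun c : EuclideanSpace ℝ (Fin d) => ∫⁻ x in cube 0 1,
      ω.indicator (fun y => ‖F y‖ₑ ^ 2) (c + a • x) * 1 := by
    refine Measurable.lintegral_prod_right' (f := fun q : EuclideanSpace ℝ (Fin d) ×
      EuclideanSpace ℝ (Fin d) => ω.indicator (fun y => ‖F y‖ₑ ^ 2) (q.1 + a • q.2) * 1) ?_
    fun_prop
  have hm2 : Measurable fun c : EuclideanSpace ℝ (Fin d) =>
      ∫⁻ x, ‖F (c + a • x)‖ₑ ^ 2 * ‖ψ x‖ₑ ^ 2 := by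
    refine Measurable.lintegral_prod_right' (f := fun q : EuclideanSpace ℝ (Fin d) ×
      EuclideanSpace ℝ (Fin d) => ‖F (q.1 + a • q.2)‖ₑ ^ 2 * ‖ψ q.2‖ₑ ^ 2) ?_
    exact (hFm.comp (by fun_prop)).mul (hψm.comp (by fun_prop))
  rw [lintegral_add_left (hm1.const_mul _), lintegral_const_mul _ hm1, lintegral_const_mul _ hm2,
    lintegral_lintegral_affine _ hFm measurable_const, lintegral_lintegral_affine _ hind
      measurable_const, lintegral_lintegral_affine _ hFm hψm, setLIntegral_const,
    volume_cube_zero_one, mul_one, mul_one, mul_one, lintegral_indicator hω] at hint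
  set X := ∫⁻ x, ‖F x‖ₑ ^ 2 with hX
  set Y := ∫⁻ x in ω, ‖F x‖ₑ ^ 2 with hY
  have hYX : Y ≤ X := setLIntegral_le_lintegral _ _
  have hYfin : Y ≠ ⊤ := (hYX.trans_lt hfin.lt_top).ne
  rw [← ENNReal.ofReal_toReal hfin, ← ENNReal.ofReal_toReal hYfin, ← ENNReal.ofReal_toReal hψfin,
    ← hP, ← ENNReal.ofReal_mul (by positivity), ← ENNReal.ofReal_mul (by positivity),
    ← ENNReal.ofReal_mul hε0, ← ENNReal.ofReal_add (by positivity) (by positivity),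
    ENNReal.ofReal_le_ofReal_iff (by positivity)] at hint
  have hX0 : 0 ≤ X.toReal := ENNReal.toReal_nonneg
  have hreal : X.toReal ≤ 2 * Λ * Y.toReal := by
    nlinarith [mul_le_mul_of_nonneg_right hεP hX0]
  calc X = ENNReal.ofReal X.toReal := (ENNReal.ofReal_toReal hfin).symm
    _ ≤ ENNReal.ofReal (2 * Λ * Y.toReal) := ENNReal.ofReal_le_ofReal hreal
    _ = ENNReal.ofReal (2 * Λ) * Y := by
        rw [ENNReal.ofReal_mul (by positivity), ENNReal.ofReal_toReal hYfin]
    _ ≤ _ := by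
        gcongr
        exact hC γ hγ hγ1 (a * r) har n hn2

/-! ### From L² classes to Fourier integrals -/

/-- Vanishing a.e. near each point outside the ball gives vanishing a.e. outside it, because a
locally null set is null. The dilation by 2π between the two normalisations preserves null sets. -/
theorem ae_eq_zero_of_essSupport_subset {d : ℕ}
    (f : Lp ℂ 2 (volume : Measure (EuclideanSpace ℝ (Fin d)))) {N : ℝ}
    (hf : essSupport (fourierHat f) ⊆ Metric.closedBall 0 N) :
    ∀ᵐ ξ : EuclideanSpace ℝ (Fin d), N / (2 * Real.pi) < ‖ξ‖ →
      (𝓕 f : Lp ℂ 2 (volume : Measure (EuclideanSpace ℝ (Fin d)))) ξ = 0 := by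
  have hpi : (0 : ℝ) < 2 * Real.pi := by positivity
  have h1 : ∀ᵐ ξ : EuclideanSpace ℝ (Fin d), N < ‖ξ‖ → fourierHat f ξ = 0 := by
    rw [ae_iff]
    refine measure_null_of_locally_null _ fun ξ hξ => ?_
    simp only [Classical.not_imp, Set.mem_ofPred_eq] at hξ
    have hns : ξ ∉ essSupport (fourierHat f) := fun h => by
      have := hf h
      rw [mem_closedBall_zero_iff] at this
      linarith [hξ.1]
    simp only [essSupport, Set.mem_ofPred_eq, not_forall, not_not] at hns
    obtain ⟨U, hU, hU0⟩ := hns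
    refine ⟨_, ?_, hU0⟩
    rw [mem_nhdsWithin_iff_exists_mem_nhds_inter]
    refine ⟨U, hU, fun η hη => ⟨hη.1, ?_⟩⟩
    have := hη.2
    simp only [Classical.not_imp, Set.mem_ofPred_eq] at this
    exact this.2
  have h2 := (Measure.quasiMeasurePreserving_smul
    (volume : Measure (EuclideanSpace ℝ (Fin d))) hpi.ne').ae h1
  filter_upwards [h2] with ξ hξ hlt
  have h3 : N < ‖(2 * Real.pi) • ξ‖ := by
    rw [norm_smul, Real.norm_eq_abs, abs_of_pos hpi]
    rwa [div_lt_iff₀' hpi] at hlt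
  have h4 := hξ h3
  rwa [fourierHat, smul_smul, inv_mul_cancel₀ hpi.ne', one_smul] at h4

open scoped ContDiff in
/-- If the `L²` Fourier transform of `f` is an integrable function `g`, then `f` is given by the
inverse Fourier integral of `g`. -/
theorem ae_eq_fourierInv {d : ℕ} (f : Lp ℂ 2 (volume : Measure (EuclideanSpace ℝ (Fin d))))
    {g : EuclideanSpace ℝ (Fin d) → ℂ} (hg : Integrable g)
    (hfg : (𝓕 f : Lp ℂ 2 (volume : Measure (EuclideanSpace ℝ (Fin d)))) =ᵐ[volume] g) :
    f =ᵐ[volume] 𝓕⁻ g := by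
  refine ae_eq_of_integral_contDiff_smul_eq
    ((Lp.memLp f).locallyIntegrable (by norm_num))
    (continuous_fourierInv hg).locallyIntegrable fun φ hφ hφc => ?_
  have hsm : ContDiff ℝ ∞ (fun x => (φ x : ℂ)) := Complex.ofRealCLM.contDiff.comp hφ
  have hcs : HasCompactSupport (fun x => (φ x : ℂ)) := hφc.comp_left Complex.ofReal_zero
  let Φ : SchwartzMap (EuclideanSpace ℝ (Fin d)) ℂ := hcs.toSchwartzMap hsm
  have hΦ : ∀ x, Φ x = (φ x : ℂ) := fun _ => rfl
  -- Plancherel turns the pairing of f with φ into one of g with the conjugate of 𝓕 Φ. As φ is real,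
  -- that conjugate is 𝓕⁻ Φ, and duality moves the inverse transform onto g.
  have h1 := Lp.inner_fourier_eq (Φ.toLp 2) f
  rw [SchwartzMap.toLp_fourier_eq, L2.inner_def, L2.inner_def] at h1
  have hL : ∫ x, inner ℂ (((𝓕 Φ).toLp 2 : Lp ℂ 2 volume) x)
      ((𝓕 f : Lp ℂ 2 (volume : Measure (EuclideanSpace ℝ (Fin d)))) x) =
      ∫ x, g x * 𝓕⁻ (Φ : EuclideanSpace ℝ (Fin d) → ℂ) x := by
    refine integral_congr_ae ?_
    filter_upwards [(𝓕 Φ).coeFn_toLp 2 volume, hfg] with x hx hx'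
    rw [hx, hx', RCLike.inner_apply, SchwartzMap.fourier_coe]
    congr 1
    rw [Real.fourierInv_eq, Real.fourier_eq, ← integral_conj]
    refine integral_congr_ae (Filter.Eventually.of_forall fun ξ => ?_)
    simp only [Circle.smul_def, smul_eq_mul, map_mul, hΦ, Complex.conj_ofReal]
    rw [AddChar.map_neg_eq_inv, Circle.coe_inv_eq_conj, Complex.conj_conj]
  have hR : ∫ x, inner ℂ ((Φ.toLp 2 : Lp ℂ 2 volume) x) (f x) = ∫ x, φ x • f x := by
    refine integral_congr_ae ?_
    filter_upwards [Φ.coeFn_toLp 2 volume] with x hx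
    rw [hx, RCLike.inner_apply, hΦ, Complex.conj_ofReal, Complex.real_smul, mul_comm]
  rw [hL, hR, ← integral_fourierInv_mul hg Φ.integrable] at h1
  rw [← h1]
  refine integral_congr_ae (Filter.Eventually.of_forall fun x => ?_)
  simp only [hΦ, Complex.real_smul, mul_comm]

theorem eLpNorm_two_sq {α : Type*} [MeasurableSpace α] (μ : Measure α) (f : α → ℂ) :
    eLpNorm f 2 μ ^ 2 = ∫⁻ x, ‖f x‖ₑ ^ 2 ∂μ := by
  have := eLpNorm_nnreal_pow_eq_lintegral (f := f) (μ := μ) (p := 2) (by norm_num)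
  simpa using this

end LogvinenkoSereda

theorem mainTheorem6 (d : ℕ) (hd : 1 ≤ d) :
    ∃ C : ℝ, 0 < C ∧
      ∀ γ : ℝ, 0 < γ → γ ≤ 1 →
      ∀ a : ℝ, 0 < a →
      ∀ ω : Set (EuclideanSpace ℝ (Fin d)), NullMeasurableSet ω volume →
        LogvinenkoSereda.IsThick γ a ω →
      ∀ N : ℝ, 0 ≤ N →
      ∀ f : Lp ℂ 2 (volume : Measure (EuclideanSpace ℝ (Fin d))),
        LogvinenkoSereda.essSupport (LogvinenkoSereda.fourierHat f) ⊆ Metric.closedBall 0 N →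
        eLpNorm f 2 volume ≤
          ENNReal.ofReal ((C / γ) ^ (C * (N * a + 1))) * eLpNorm f 2 (volume.restrict ω) := by
  obtain ⟨C₀, hC₀, hest⟩ := LogvinenkoSereda.exists_const_lintegral_le d
  -- The added 1 makes the base (C₀ + 1)/γ at least 1, so that the exponent may be enlarged at the
  -- end.
  refine ⟨C₀ + 1, by positivity, fun γ hγ hγ1 a ha ω hω hth N hN f hf => ?_⟩
  have hpi : (0 : ℝ) < 2 * Real.pi := by positivity
  set r := N / (2 * Real.pi) with hr
  have hr0 : 0 ≤ r := by positivity
  set G : Lp ℂ 2 (volume : Measure (EuclideanSpace ℝ (Fin d))) := 𝓕 f with hG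
  set B := Metric.closedBall (0 : EuclideanSpace ℝ (Fin d)) r with hB
  have hBm : MeasurableSet B := Metric.isClosed_closedBall.measurableSet
  -- Cutting off to the ball gives a representative that vanishes everywhere outside it and is
  -- integrable, since L² ⊆ L¹ on a set of finite measure.
  set g := B.indicator G with hg
  have hgi : Integrable g := by
    rw [hg, integrable_indicator_iff hBm]
    have : IsFiniteMeasure (volume.restrict B) :=
      ⟨by rw [Measure.restrict_apply_univ]; exact measure_closedBall_lt_top⟩
    exact ((Lp.memLp G).restrict B).integrable (by norm_num)
  have hg0 : ∀ ξ, r < ‖ξ‖ → g ξ = 0 := fun ξ hξ =>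
    Set.indicator_of_notMem (by simpa [hB] using hξ) _
  have hGg : G =ᵐ[volume] g := by
    filter_upwards [LogvinenkoSereda.ae_eq_zero_of_essSupport_subset f hf] with ξ hξ
    by_cases h : r < ‖ξ‖
    · rw [hg0 ξ h, hξ h]
    · rw [hg, Set.indicator_of_mem (by simpa [hB] using h)]
  have hfg := LogvinenkoSereda.ae_eq_fourierInv f hgi hGg
  obtain ⟨ω', -, hω'm, hω'⟩ := hω.exists_measurable_superset_ae_eq
  have hth' : LogvinenkoSereda.IsThick γ a ω' := fun x => by
    rw [measure_congr (hω'.inter (Filter.EventuallyEq.refl _ (LogvinenkoSereda.cube x a)))]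
    exact hth x
  have hfin : ∫⁻ x, ‖𝓕⁻ g x‖ₑ ^ 2 ≠ ⊤ := by
    rw [← LogvinenkoSereda.eLpNorm_two_sq, ← eLpNorm_congr_ae hfg]
    exact ENNReal.pow_ne_top (Lp.eLpNorm_ne_top f)
  have key := hest γ hγ hγ1 a ha ω' hω'm hth' r hr0 g hgi hg0 hfin
  rw [← LogvinenkoSereda.eLpNorm_two_sq, ← LogvinenkoSereda.eLpNorm_two_sq,
    ← eLpNorm_congr_ae hfg, ← eLpNorm_congr_ae (ae_restrict_of_ae hfg),
    Measure.restrict_congr_set hω', ENNReal.ofReal_pow (by positivity), ← mul_pow] at key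
  refine ((ENNReal.pow_le_pow_left_iff two_ne_zero).1 key).trans ?_
  gcongr
  have h1 : 1 ≤ (C₀ + 1) / γ := by rw [le_div_iff₀ hγ]; linarith
  have hle : a * r ≤ N * a := by
    rw [hr, mul_comm N a]
    refine mul_le_mul_of_nonneg_left (div_le_self hN ?_) ha.le
    have := Real.pi_gt_three
    linarith
  calc (C₀ / γ) ^ (C₀ * (a * r + 1)) ≤ ((C₀ + 1) / γ) ^ (C₀ * (a * r + 1)) := by
        gcongr
        linarith
    _ ≤ _ := by
        refine Real.rpow_le_rpow_of_exponent_le h1 ?_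
        have : 0 ≤ a * r := by positivity
        nlinarith
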